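/- Let $n\ge 0$, $\varepsilon>0$, let $V_0:\mathbb R^n\to\mathbb R$ be smooth and let $e:\mathbb R\to\mathbb R^n$ be twice continuously differentiable on $[0,\infty)$ (the laser field). For $t\ge 0$, $h>0$ put $$r=\tfrac1h\int_0^h e(t+\zeta)\,d\zeta,\qquad s=2\int_0^h\bigl(\zeta-\tfrac h2\bigr)e(t+\zeta)\,d\zeta,\qquad q=\int_0^h\bigl(\zeta^2-h\zeta+\tfrac16h^2\bigr)e(t+\zeta)\,d\zeta,$$ $$p=\tfrac13\int_0^h\bigl(\zeta^3-\tfrac32h\zeta^2+\tfrac12h^2\zeta\bigr)e(t+\zeta)\,d\zeta,\qquad \tilde s=s-12h^{-2}p,\qquad \widetilde V(x)=V_0(x)+r^{\top}x,$$ $$c=i\varepsilon^{-1}\Bigl(2\int_0^h\zeta\,e(t+\zeta)^{\top}\!\int_0^\zeta e(t+\xi)\,d\xi\,d\zeta-\Bigl(\int_0^h e(t+\zeta)\,d\zeta\Bigr)^{\!\top}\Bigl(\int_0^h\zeta e(t+\zeta)\,d\zeta\Bigr)-\tfrac h6\Bigl|\int_0^h e(t+\zeta)\,d\zeta\Bigr|^2\Bigr),\qquad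 \tilde c=c-i\varepsilon^{-1}q^{\top}r .$$ Let the sixth-order truncated Magnus expansion of the Schrödinger equation $i\varepsilon\,\partial_tu=(-\varepsilon^2\Delta+V_0(x)+e(t)^{\top}x)u$ be $$\Theta_4=ih\varepsilon\Delta-ih\varepsilon^{-1}\widetilde V-s^{\top}\nabla+i\varepsilon^{-1}q^{\top}(\nabla V_0)+[\Delta,p^{\top}(\nabla V_0)]+c,$$ and put $$L_3=-6i\varepsilon^{-1}h^{-2}q^{\top}x,\qquad C_2=-12h^{-2}p^{\top}\nabla,\qquad T_2=ih\varepsilon\Delta-\tilde s^{\top}\nabla,\qquad W_3=-ih\varepsilon^{-1}\widetilde V-L_3+\tilde c,$$ none of which contains a commutator or $\nabla V_0$. Then $$e^{\frac12L_3}\,e^{\frac12C_2}\,e^{T_2+W_3}\,e^{\frac12C_2}\,e^{\frac12L_3}=e^{\Theta_4}+O(h^7)$$ in the following sense. Let $D$ be any space of smooth functions in $L^2(\mathbb R^n;\mathbb C)$ that is stable under all derivatives $a^{\top}\nabla$ and under multiplication by $a^{\top}x$ ($a\in\mathbb R^n$) and by $V_0$ (for instance $C_c^\infty(\mathbb R^n)$,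 or the Schwartz space if all derivatives of $V_0$ are polynomially bounded). For a differential operator $A$, let $e^A$ denote the value at $\sigma=1$ of any strongly continuous one-parameter group $(e^{\sigma A})_{\sigma\in\mathbb R}$ of unitary operators on $L^2(\mathbb R^n;\mathbb C)$ whose infinitesimal generator agrees with $A$ on $D$. Then for all $u\in D$ and $T\ge 0$ there are $C$ and $h_0>0$, depending only on $n,\varepsilon,V_0,e,D,u,T$ (and not on the choice of the groups), such that for all $t\in[0,T]$ and $0<h\le h_0$ $$\bigl\|e^{\frac12L_3}e^{\frac12C_2}e^{T_2+W_3}e^{\frac12C_2}e^{\frac12L_3}u-e^{\Theta_4}u\bigr\|_{L^2}\le C\,h^7 .$$ -/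

import Mathlib

open Complex MeasureTheory Set Laplacian Gradient
open scoped ContDiff

noncomputable section

namespace LaserSplitting

/-- The physical space `ℝⁿ` with its Euclidean structure. -/
abbrev Space (n : ℕ) : Type := EuclideanSpace ℝ (Fin n)

/-- The Hilbert space `L²(ℝⁿ; ℂ)`. -/
abbrev L2 (n : ℕ) : Type := Lp ℂ 2 (volume : Measure (Space n))

/-- The complex vector space of smooth functions `ℝⁿ → ℂ`, on which linear differential
operators with smooth coefficients act. -/
def Smooth (n : ℕ) : Submodule ℂ (Space n → ℂ) where
  carrier := {u | ContDiff ℝ ∞ u}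
  add_mem' := by
    intro u v hu hv
    rw [Set.mem_ofPred_eq] at *
    exact hu.add hv
  zero_mem' := by
    rw [Set.mem_ofPred_eq]
    exact contDiff_const
  smul_mem' := by
    intro c u hu
    rw [Set.mem_ofPred_eq] at *
    exact hu.const_smul c

theorem smooth_contDiff {n : ℕ} (u : Smooth n) : ContDiff ℝ ∞ u.1 := u.2

/-! ### Differential operators -/

/-- Multiplication by the smooth real function `f`. -/
def mulOp {n : ℕ} (f : Space n → ℝ) (hf : ContDiff ℝ ∞ f) : Module.End ℂ (Smooth n) where
  toFun u := ⟨fun x => (f x : ℂ) * u.1 x, (ofRealCLM.contDiff.comp hf).mul (smooth_contDiff u)⟩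
  map_add' u v := Subtype.ext (funext fun x => mul_add (f x : ℂ) (u.1 x) (v.1 x))
  map_smul' c u := Subtype.ext (funext fun x => mul_left_comm (f x : ℂ) c (u.1 x))

/-- The constant coefficient first order operator `aᵀ∇`. -/
def dirOp {n : ℕ} (a : Space n) : Module.End ℂ (Smooth n) where
  toFun u := ⟨fun x => fderiv ℝ u.1 x a,
    ((smooth_contDiff u).fderiv_right (m := ∞) (by simp)).clm_apply contDiff_const⟩
  map_add' u v := by
    have hu : Differentiable ℝ u.1 := (smooth_contDiff u).differentiable (by simp)
    have hv : Differentiable ℝ v.1 := (smooth_contDiff v).differentiable (by simp)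
    refine Subtype.ext (funext fun x => ?_)
    change fderiv ℝ (u.1 + v.1) x a = fderiv ℝ u.1 x a + fderiv ℝ v.1 x a
    rw [fderiv_add (hu x) (hv x)]
    rfl
  map_smul' c u := by
    have hu : Differentiable ℝ u.1 := (smooth_contDiff u).differentiable (by simp)
    refine Subtype.ext (funext fun x => ?_)
    change fderiv ℝ (c • u.1) x a = c • fderiv ℝ u.1 x a
    rw [fderiv_const_smul (hu x)]
    rfl

theorem contDiff_laplacian {n : ℕ} {u : Space n → ℂ} (hu : ContDiff ℝ ∞ u) :
    ContDiff ℝ ∞ (Δ u) := by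
  rw [InnerProductSpace.laplacian_eq_iteratedFDeriv_orthonormalBasis u
    (EuclideanSpace.basisFun (Fin n) ℝ)]
  refine ContDiff.sum fun i _ => ?_
  have h : ContDiff ℝ ∞ (iteratedFDeriv ℝ 2 u) :=
    hu.iteratedFDeriv_right (m := ∞) (by rfl)
  exact (ContinuousMultilinearMap.apply ℝ (fun _ : Fin 2 => Space n) ℂ _).contDiff.comp h

/-- The Laplacian. -/
def lapOp (n : ℕ) : Module.End ℂ (Smooth n) where
  toFun u := ⟨Δ u.1, contDiff_laplacian (smooth_contDiff u)⟩
  map_add' u v := Subtype.ext (funext fun x =>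
    ContDiffAt.laplacian_add
      (by exact_mod_cast (contDiff_infty.1 (smooth_contDiff u) 2).contDiffAt)
      (by exact_mod_cast (contDiff_infty.1 (smooth_contDiff v) 2).contDiffAt))
  map_smul' c u := Subtype.ext (funext fun x =>
    InnerProductSpace.laplacian_smul c
      (by exact_mod_cast (contDiff_infty.1 (smooth_contDiff u) 2).contDiffAt))

theorem contDiff_lin {n : ℕ} (a : Space n) : ContDiff ℝ ∞ fun x : Space n => inner ℝ a x :=
  contDiff_const.inner ℝ contDiff_id

theorem contDiff_dot_gradient {n : ℕ} {V₀ : Space n → ℝ} (hV : ContDiff ℝ ∞ V₀) (a : Space n) :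
    ContDiff ℝ ∞ fun x : Space n => inner ℝ a (∇ V₀ x) := by
  refine contDiff_const.inner ℝ ?_
  exact (InnerProductSpace.toDual ℝ (Space n)).symm.toContinuousLinearEquiv.contDiff.comp
    (hV.fderiv_right (m := ∞) (by simp))

/-- Multiplication by the linear function `aᵀx`. -/
def linOp {n : ℕ} (a : Space n) : Module.End ℂ (Smooth n) :=
  mulOp (fun x => inner ℝ a x) (contDiff_lin a)

/-- Multiplication by the function `aᵀ(∇V₀)`. -/
def gradOp {n : ℕ} (V₀ : Space n → ℝ) (hV : ContDiff ℝ ∞ V₀) (a : Space n) :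
    Module.End ℂ (Smooth n) :=
  mulOp (fun x => inner ℝ a (∇ V₀ x)) (contDiff_dot_gradient hV a)

/-! ### Moments of the laser field -/

/-- `r(t,h) = h⁻¹ ∫₀ʰ e(t+ζ) dζ`. -/
def rVec {n : ℕ} (e : ℝ → Space n) (t h : ℝ) : Space n :=
  h⁻¹ • ∫ ζ in (0 : ℝ)..h, e (t + ζ)

/-- `s(t,h) = 2 ∫₀ʰ (ζ - h/2) e(t+ζ) dζ`. -/
def sVec {n : ℕ} (e : ℝ → Space n) (t h : ℝ) : Space n :=
  (2 : ℝ) • ∫ ζ in (0 : ℝ)..h, (ζ - h / 2) • e (t + ζ)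

/-- `q(t,h) = ∫₀ʰ (ζ² - hζ + h²/6) e(t+ζ) dζ`. -/
def qVec {n : ℕ} (e : ℝ → Space n) (t h : ℝ) : Space n :=
  ∫ ζ in (0 : ℝ)..h, (ζ ^ 2 - h * ζ + h ^ 2 / 6) • e (t + ζ)

/-- `p(t,h) = ⅓ ∫₀ʰ (ζ³ - (3/2)hζ² + (1/2)h²ζ) e(t+ζ) dζ`. -/
def pVec {n : ℕ} (e : ℝ → Space n) (t h : ℝ) : Space n :=
  (1 / 3 : ℝ) • ∫ ζ in (0 : ℝ)..h, (ζ ^ 3 - 3 / 2 * h * ζ ^ 2 + 1 / 2 * h ^ 2 * ζ) • e (t + ζ)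

/-- `s̃ = s - 12 h⁻² p`. -/
def sTilde {n : ℕ} (e : ℝ → Space n) (t h : ℝ) : Space n :=
  sVec e t h - (12 / h ^ 2) • pVec e t h

/-- The scalar `c(t,h)` of the simplified Magnus expansion. -/
def cScalar {n : ℕ} (ε : ℝ) (e : ℝ → Space n) (t h : ℝ) : ℂ :=
  I / ε *
    (2 * (∫ ζ in (0 : ℝ)..h, ζ * inner ℝ (e (t + ζ)) (∫ ξ in (0 : ℝ)..ζ, e (t + ξ)))
      - inner ℝ (∫ ζ in (0 : ℝ)..h, e (t + ζ)) (∫ ζ in (0 : ℝ)..h, ζ • e (t + ζ))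
      - 1 / 6 * h * ‖∫ ζ in (0 : ℝ)..h, e (t + ζ)‖ ^ 2 : ℝ)

/-- `c̃ = c - iε⁻¹ qᵀr`. -/
def cTilde {n : ℕ} (ε : ℝ) (e : ℝ → Space n) (t h : ℝ) : ℂ :=
  cScalar ε e t h - I / ε * (inner ℝ (qVec e t h) (rVec e t h) : ℝ)

/-! ### The exponents -/

/-- Multiplication by `Ṽ = V₀ + rᵀx`. -/
def vTildeOp {n : ℕ} (V₀ : Space n → ℝ) (hV : ContDiff ℝ ∞ V₀) (e : ℝ → Space n) (t h : ℝ) :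
    Module.End ℂ (Smooth n) :=
  mulOp V₀ hV + linOp (rVec e t h)

/-- The sixth-order truncated Magnus expansion
`Θ₄ = ihεΔ - ihε⁻¹Ṽ - sᵀ∇ + iε⁻¹ qᵀ(∇V₀) + [Δ, pᵀ(∇V₀)] + c`. -/
def theta4 {n : ℕ} (ε : ℝ) (V₀ : Space n → ℝ) (hV : ContDiff ℝ ∞ V₀) (e : ℝ → Space n)
    (t h : ℝ) : Module.End ℂ (Smooth n) :=
  (I * h * ε) • lapOp n - (I * h / ε) • vTildeOp V₀ hV e t h - dirOp (sVec e t h)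
    + (I / ε) • gradOp V₀ hV (qVec e t h) + ⁅lapOp n, gradOp V₀ hV (pVec e t h)⁆
    + cScalar ε e t h • 1

/-- `L₃ = -6iε⁻¹h⁻² qᵀx`. -/
def L3 {n : ℕ} (ε : ℝ) (e : ℝ → Space n) (t h : ℝ) : Module.End ℂ (Smooth n) :=
  (-(6 * I / (ε * h ^ 2))) • linOp (qVec e t h)

/-- `C₂ = -12h⁻² pᵀ∇`. -/
def C2 {n : ℕ} (e : ℝ → Space n) (t h : ℝ) : Module.End ℂ (Smooth n) :=
  -dirOp ((12 / h ^ 2) • pVec e t h)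

/-- `T₂ = ihεΔ - s̃ᵀ∇`. -/
def T2 {n : ℕ} (ε : ℝ) (e : ℝ → Space n) (t h : ℝ) : Module.End ℂ (Smooth n) :=
  (I * h * ε) • lapOp n - dirOp (sTilde e t h)

/-- `W₃ = -ihε⁻¹Ṽ - L₃ + c̃`, multiplication by a function. -/
def W3 {n : ℕ} (ε : ℝ) (V₀ : Space n → ℝ) (hV : ContDiff ℝ ∞ V₀) (e : ℝ → Space n)
    (t h : ℝ) : Module.End ℂ (Smooth n) :=
  -((I * h / ε) • vTildeOp V₀ hV e t h) - L3 ε e t h + cTilde ε e t h • 1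

/-! ### Exponentials of differential operators -/

/-- `D` is a space of square-integrable smooth functions which is stable under the derivatives
`aᵀ∇`, under multiplication by `aᵀx` and under multiplication by `V₀`. For instance
`C_c^∞(ℝⁿ)`, or the Schwartz space if the derivatives of `V₀` are polynomially bounded. -/
structure IsTestSpace {n : ℕ} (V₀ : Space n → ℝ) (hV : ContDiff ℝ ∞ V₀)
    (D : Submodule ℂ (Smooth n)) : Prop where
  memLp : ∀ u ∈ D, MemLp u.1 2 volume
  dir_mem : ∀ a, ∀ u ∈ D, dirOp a u ∈ D
  lin_mem : ∀ a, ∀ u ∈ D, linOp a u ∈ D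
  pot_mem : ∀ u ∈ D, mulOp V₀ hV u ∈ D

/-- `U = e^A`: the unitary operator `U` on `L²` is the value at time one of a strongly continuous
one-parameter group of unitary operators `G s = e^{sA}` whose infinitesimal generator is `A` on
the functions in `D`, that is, `d/ds (G s u) = A u` at `s = 0`, in `L²`, for all `u ∈ D`. -/
def IsExp {n : ℕ} (D : Submodule ℂ (Smooth n)) (A : Module.End ℂ (Smooth n))
    (U : L2 n ≃ₗᵢ[ℂ] L2 n) : Prop :=
  ∃ G : ℝ → (L2 n ≃ₗᵢ[ℂ] L2 n),
    (∀ s t f, G (s + t) f = G s (G t f)) ∧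
    (∀ f, Continuous fun s => G s f) ∧
    (∀ u ∈ D, ∀ f : L2 n, f =ᵐ[volume] u.1 →
      ∃ g : L2 n, g =ᵐ[volume] (A u).1 ∧ HasDerivAt (fun s => G s f) g 0) ∧
    U = G 1

end LaserSplitting

end

/-! Write `X = T₂ + W₃`, which is `O(h)`, and `B = C₂ + L₃`, which is `O(h³)`. A palindromic product
has no even terms in its Baker–Campbell–Hausdorff series, so formally the splitting is the
exponential of `X + B + [X,[X,B]]/12 + O(h⁷)`: the next terms, such as `[B,[B,X]]`, already have
order seven. Up to `O(h⁷)`, `X` may be replaced inside the double commutator by `X₀ = ihεΔ -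
ihε⁻¹Ṽ`, and then `[X₀,[X₀,B]]/12` is exactly `iε⁻¹qᵀ∇V₀ + [Δ, pᵀ∇V₀] + iε⁻¹qᵀr`; the last scalar is
what `c̃` removes. The exponent is therefore `Θ₄` (`theta4_eq`, `IsFiltration.exponent_sub_mem`).

The generators are unbounded, so no series is summed. Each group is unitary, hence the Taylor
polynomial of degree below `m` approximates `e^A v` with error at most `‖A^m v‖` for `v ∈ D`
(`norm_group_sub_sum_le`). With `A = O(hⁱ)` and `im ≥ 7` this is `O(h⁷)`; it remains to compare
polynomials in a filtered algebra (`splitting_sub_mem`).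

Uniformity in `(t,h)` comes from working in the ring of families of operators indexed by all
`(t,h)`, filtered by `familyOrder`. The orders of the exponents follow from the vanishing moments of
the kernels of `s`, `q` and `p` (`exists_moment_bounds`). -/

namespace LaserSplitting

/-! ### Sixth order symmetric splitting in a filtered algebra -/

section Filtered

variable {R : Type*} [Ring R] [Algebra ℂ R]

/-- A decreasing multiplicative filtration of an algebra by subspaces. -/
structure IsFiltration (F : ℕ → Submodule ℂ R) : Prop where
  one_mem : 1 ∈ F 0
  anti : Antitone F
  mul_mem : ∀ {i j a b}, a ∈ F i → b ∈ F j → a * b ∈ F (i + j)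

/-- `A` is the sum of the homogeneous parts `a k`, `k < 7`, up to terms of order seven. -/
structure HasParts (F : ℕ → Submodule ℂ R) (A : R) (a : ℕ → R) : Prop where
  mem : ∀ k < 7, a k ∈ F k
  rem : A - ∑ k ∈ Finset.range 7, a k ∈ F 7

/-- The Cauchy product of two sequences. -/
def cauchy (a b : ℕ → R) (k : ℕ) : R := ∑ i ∈ Finset.range (k + 1), a i * b (k - i)

/-- The sequence with the given first seven members. -/
def parts (a₀ a₁ a₂ a₃ a₄ a₅ a₆ : R) : ℕ → R
  | 0 => a₀ | 1 => a₁ | 2 => a₂ | 3 => a₃ | 4 => a₄ | 5 => a₅ | 6 => a₆ | _ => 0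

variable {F : ℕ → Submodule ℂ R} {A B : R} {a b : ℕ → R}

theorem HasParts.congr (hA : HasParts F A a) (h : ∀ k < 7, a k = b k) : HasParts F A b where
  mem k hk := h k hk ▸ hA.mem k hk
  rem := by
    rw [← Finset.sum_congr rfl fun k hk => h k (Finset.mem_range.1 hk)]
    exact hA.rem

/-- The comparison principle: it suffices to expand both sides of the splitting and match their
parts. -/
theorem HasParts.sub_mem (hA : HasParts F A a) (hB : HasParts F B a) : A - B ∈ F 7 := by
  simpa using (F 7).sub_mem hA.rem hB.rem

theorem HasParts.add (hA : HasParts F A a) (hB : HasParts F B b) :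
    HasParts F (A + B) (fun k => a k + b k) where
  mem k hk := (F k).add_mem (hA.mem k hk) (hB.mem k hk)
  rem := by
    rw [Finset.sum_add_distrib, add_sub_add_comm]
    exact (F 7).add_mem hA.rem hB.rem

theorem HasParts.smul (c : ℂ) (hA : HasParts F A a) : HasParts F (c • A) (fun k => c • a k) where
  mem k hk := (F k).smul_mem c (hA.mem k hk)
  rem := by
    rw [← Finset.smul_sum, ← smul_sub]
    exact (F 7).smul_mem c hA.rem

theorem HasParts.mul (hF : IsFiltration F) (hA : HasParts F A a) (hB : HasParts F B b) :
    HasParts F (A * B) (cauchy a b) where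
  mem k hk := (F k).sum_mem fun i hi => by
    have hi' : i ≤ k := Nat.lt_succ_iff.1 (Finset.mem_range.1 hi)
    have := hF.mul_mem (hA.mem i (by omega)) (hB.mem (k - i) (by omega))
    rwa [Nat.add_sub_cancel' hi'] at this
  rem := by
    have hm : ∀ {D : R} {d : ℕ → R}, HasParts F D d → D ∈ F 0 := fun {D d} hD => by
      rw [← sub_add_cancel D (∑ k ∈ Finset.range 7, d k)]
      exact (F 0).add_mem (hF.anti (Nat.zero_le 7) hD.rem)
        ((F 0).sum_mem fun k hk => hF.anti (Nat.zero_le k) (hD.mem k (Finset.mem_range.1 hk)))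
    have hs : ∑ k ∈ Finset.range 7, b k ∈ F 0 :=
      (F 0).sum_mem fun k hk => hF.anti (Nat.zero_le k) (hB.mem k (Finset.mem_range.1 hk))
    -- The remainder splits as `A (B - Σb) + (A - Σa) Σb` plus the products `a i * b j` with `i + j
    -- ≥ 7`.
    have h1 := hF.mul_mem (hm hA) hB.rem
    have h2 := hF.mul_mem hA.rem hs
    have h3 : (∑ k ∈ Finset.range 7, a k) * (∑ k ∈ Finset.range 7, b k)
        - ∑ k ∈ Finset.range 7, cauchy a b k ∈ F 7 := by
      have : (∑ k ∈ Finset.range 7, a k) * (∑ k ∈ Finset.range 7, b k)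
          - ∑ k ∈ Finset.range 7, cauchy a b k
          = ∑ i ∈ Finset.range 7, ∑ j ∈ Finset.range 7, if 7 ≤ i + j then a i * b j else 0 := by
        simp only [cauchy, Finset.sum_range_succ, Finset.sum_range_zero]
        norm_num
        simp only [mul_add, add_mul]
        abel
      rw [this]
      refine (F 7).sum_mem fun i hi => (F 7).sum_mem fun j hj => ?_
      split_ifs with h
      · exact hF.anti h (hF.mul_mem (hA.mem i (Finset.mem_range.1 hi))
          (hB.mem j (Finset.mem_range.1 hj)))
      · exact (F 7).zero_mem
    rw [zero_add] at h1
    have := (F 7).add_mem (F 7 |>.add_mem h1 h2) h3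
    convert this using 1
    noncomm_ring

/-- The Taylor polynomial of degree less than `m` of the exponential. -/
noncomputable def expPoly (m : ℕ) (A : R) : R := ∑ k ∈ Finset.range m, ((k.factorial : ℂ)⁻¹) • A ^ k

theorem IsFiltration.neg_mem (_ : IsFiltration F) {i : ℕ} (hA : A ∈ F i) : -A ∈ F i :=
  (F i).neg_mem hA

theorem IsFiltration.sub_mem (_ : IsFiltration F) {i : ℕ} (hA : A ∈ F i) (hB : B ∈ F i) :
    A - B ∈ F i :=
  (F i).sub_mem hA hB

theorem IsFiltration.pow_mem (hF : IsFiltration F) {i : ℕ} (hA : A ∈ F i) (k : ℕ) :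
    A ^ k ∈ F (i * k) := by
  induction k with
  | zero => simpa using hF.one_mem
  | succ k ih => rw [pow_succ, mul_add, mul_one]; exact hF.mul_mem ih hA

theorem forall_lt_seven {p : ℕ → Prop} :
    (∀ k < 7, p k) ↔ p 0 ∧ p 1 ∧ p 2 ∧ p 3 ∧ p 4 ∧ p 5 ∧ p 6 := by
  refine ⟨fun h => ⟨h 0 (by omega), h 1 (by omega), h 2 (by omega), h 3 (by omega), h 4 (by omega),
    h 5 (by omega), h 6 (by omega)⟩, fun h k hk => ?_⟩
  obtain ⟨h0, h1, h2, h3, h4, h5, h6⟩ := h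
  interval_cases k <;> assumption

theorem hasParts_expPoly_one (hF : IsFiltration F) (hA : A ∈ F 1) :
    HasParts F (expPoly 7 A) (fun k => ((k.factorial : ℂ)⁻¹) • A ^ k) where
  mem k _ := (F k).smul_mem _ (by simpa using hF.pow_mem hA k)
  rem := by simp [expPoly]

theorem hasParts_expPoly_three (hF : IsFiltration F) (hA : A ∈ F 3) :
    HasParts F (expPoly 3 A) (parts 1 0 0 A 0 0 ((1 / 2 : ℂ) • A ^ 2)) where
  mem := forall_lt_seven.2 ⟨hF.one_mem, (F 1).zero_mem, (F 2).zero_mem, hA, (F 4).zero_mem,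
    (F 5).zero_mem, (F 6).smul_mem _ (hF.pow_mem hA 2)⟩
  rem := by simp [expPoly, Finset.sum_range_succ, parts]

/-- The powers of `X + B + K`, sorted by weight with `X`, `B`, `K` of weights 1, 3, 5, are obtained
as iterated Cauchy products. -/
theorem hasParts_expPoly_theta (hF : IsFiltration F) {X B K Θ : R} (hX : X ∈ F 1) (hB : B ∈ F 3)
    (hK : K ∈ F 5) (hΘ : Θ - (X + B + K) ∈ F 7) :
    HasParts F (expPoly 7 Θ) (parts 1 X ((1 / 2 : ℂ) • X ^ 2) (B + (1 / 6 : ℂ) • X ^ 3)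
      ((1 / 2 : ℂ) • (X * B + B * X) + (1 / 24 : ℂ) • X ^ 4)
      (K + (1 / 6 : ℂ) • (X * X * B + X * B * X + B * X * X) + (1 / 120 : ℂ) • X ^ 5)
      ((1 / 2 : ℂ) • (X * K + B * B + K * X)
        + (1 / 24 : ℂ) • (X * X * X * B + X * X * B * X + X * B * X * X + B * X * X * X)
        + (1 / 720 : ℂ) • X ^ 6)) := by
  have h0 : HasParts F (1 : R) (parts 1 0 0 0 0 0 0) :=
    ⟨forall_lt_seven.2 ⟨hF.one_mem, (F 1).zero_mem, (F 2).zero_mem, (F 3).zero_mem,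
      (F 4).zero_mem, (F 5).zero_mem, (F 6).zero_mem⟩, by simp [Finset.sum_range_succ, parts]⟩
  have h1 : HasParts F Θ (parts 0 X 0 B 0 K 0) :=
    ⟨forall_lt_seven.2 ⟨(F 0).zero_mem, hX, (F 2).zero_mem, hB, (F 4).zero_mem, hK,
      (F 6).zero_mem⟩, by simpa [Finset.sum_range_succ, parts] using hΘ⟩
  have h2 := (h1.mul hF h1).congr (b := parts 0 0 (X * X) 0 (X * B + B * X) 0
    (X * K + B * B + K * X)) (forall_lt_seven.2 (by
      simp [cauchy, parts, Finset.sum_range_succ]))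
  have h3 := (h2.mul hF h1).congr (b := parts 0 0 0 (X * X * X) 0
    (X * X * B + X * B * X + B * X * X) 0) (forall_lt_seven.2 (by
      simp [cauchy, parts, Finset.sum_range_succ, add_mul, add_assoc]))
  have h4 := (h3.mul hF h1).congr (b := parts 0 0 0 0 (X * X * X * X) 0
    (X * X * X * B + X * X * B * X + X * B * X * X + B * X * X * X)) (forall_lt_seven.2 (by
      simp [cauchy, parts, Finset.sum_range_succ, add_mul, add_assoc]))
  have h5 := (h4.mul hF h1).congr (b := parts 0 0 0 0 0 (X * X * X * X * X) 0)
    (forall_lt_seven.2 (by simp [cauchy, parts, Finset.sum_range_succ]))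
  have h6 := (h5.mul hF h1).congr (b := parts 0 0 0 0 0 0 (X * X * X * X * X * X))
    (forall_lt_seven.2 (by simp [cauchy, parts, Finset.sum_range_succ]))
  have := (((((h0.add h1).add (h2.smul (1 / 2))).add (h3.smul (1 / 6))).add
    (h4.smul (1 / 24))).add (h5.smul (1 / 120))).add (h6.smul (1 / 720))
  have e : expPoly 7 Θ = 1 + Θ + (1 / 2 : ℂ) • (Θ * Θ) + (1 / 6 : ℂ) • (Θ * Θ * Θ)
      + (1 / 24 : ℂ) • (Θ * Θ * Θ * Θ) + (1 / 120 : ℂ) • (Θ * Θ * Θ * Θ * Θ)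
      + (1 / 720 : ℂ) • (Θ * Θ * Θ * Θ * Θ * Θ) := by
    simp [expPoly, Finset.sum_range_succ, Nat.factorial, pow_succ]
  rw [e]
  refine this.congr (forall_lt_seven.2 ?_)
  simp [parts, pow_succ]

/-- Here `C` and `L` stand for the half exponents. Because the product is a palindrome, only `C + L`
survives: the weight-six terms `LC` from the left and `CL` from the right combine with the mixed
terms into `2(C + L)²`. -/
theorem hasParts_symm (hF : IsFiltration F) {X C L : R} (hX : X ∈ F 1) (hC : C ∈ F 3)
    (hL : L ∈ F 3) :
    HasParts F (expPoly 3 L * (expPoly 3 C * (expPoly 7 X * (expPoly 3 C * expPoly 3 L))))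
      (parts 1 X ((1 / 2 : ℂ) • X ^ 2) ((2 : ℂ) • (C + L) + (1 / 6 : ℂ) • X ^ 3)
      (X * (C + L) + (C + L) * X + (1 / 24 : ℂ) • X ^ 4)
      ((1 / 2 : ℂ) • (X ^ 2 * (C + L) + (C + L) * X ^ 2) + (1 / 120 : ℂ) • X ^ 5)
      ((2 : ℂ) • (C + L) ^ 2 + (1 / 6 : ℂ) • (X ^ 3 * (C + L) + (C + L) * X ^ 3)
        + (1 / 720 : ℂ) • X ^ 6)) := by
  have hPL := hasParts_expPoly_three hF hL
  have hPC := hasParts_expPoly_three hF hC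
  have h1 := (hPC.mul hF hPL).congr (b := parts 1 0 0 (C + L) 0 0
    ((1 / 2 : ℂ) • C ^ 2 + C * L + (1 / 2 : ℂ) • L ^ 2)) (forall_lt_seven.2 (by
      simp [cauchy, parts, Finset.sum_range_succ]
      exact ⟨by abel, by abel⟩))
  have h2 := (hPL.mul hF hPC).congr (b := parts 1 0 0 (C + L) 0 0
    ((1 / 2 : ℂ) • C ^ 2 + L * C + (1 / 2 : ℂ) • L ^ 2)) (forall_lt_seven.2 (by
      simp [cauchy, parts, Finset.sum_range_succ]))
  have h3 := (h2.mul hF ((hasParts_expPoly_one hF hX).mul hF h1))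
  rw [mul_assoc] at h3
  refine h3.congr (forall_lt_seven.2 ?_)
  simp only [cauchy, parts, Finset.sum_range_succ, Finset.sum_range_zero, Nat.factorial]
  simp
  refine ⟨?_, ?_, ?_, ?_⟩
  · module
  · simp only [add_mul, mul_add]; module
  · simp only [add_mul, mul_add, smul_add]; module
  · simp only [add_mul, mul_add, smul_add, mul_smul_comm, pow_two (C + L), pow_two C, pow_two L]
    module

theorem IsFiltration.lie_mem (hF : IsFiltration F) {i j : ℕ} (hA : A ∈ F i) (hB : B ∈ F j) :
    ⁅A, B⁆ ∈ F (i + j) := by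
  rw [Ring.lie_def]
  exact (F (i + j)).sub_mem (hF.mul_mem hA hB) (add_comm j i ▸ hF.mul_mem hB hA)

theorem IsFiltration.mem_one_of_sub_mem (hF : IsFiltration F) {X B Θ : R} (hX : X ∈ F 1)
    (hB : B ∈ F 3) (hΘ : Θ - (X + B + (1 / 12 : ℂ) • ⁅X, ⁅X, B⁆⁆) ∈ F 7) : Θ ∈ F 1 := by
  rw [← sub_add_cancel Θ (X + B + (1 / 12 : ℂ) • ⁅X, ⁅X, B⁆⁆)]
  exact (F 1).add_mem (hF.anti (by omega) hΘ) ((F 1).add_mem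
    ((F 1).add_mem hX (hF.anti (by omega) hB))
    ((F 1).smul_mem _ (hF.anti (by omega) (hF.lie_mem hX (hF.lie_mem hX hB)))))

/-- The symmetric splitting is accurate to order six if the double commutator is included in the
exponent. -/
theorem splitting_sub_mem (hF : IsFiltration F) {X C L Θ : R} (hX : X ∈ F 1) (hC : C ∈ F 3)
    (hL : L ∈ F 3) (hΘ : Θ - (X + (C + L) + (1 / 12 : ℂ) • ⁅X, ⁅X, C + L⁆⁆) ∈ F 7) :
    expPoly 3 ((1 / 2 : ℂ) • L) * (expPoly 3 ((1 / 2 : ℂ) • C) * (expPoly 7 X *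
      (expPoly 3 ((1 / 2 : ℂ) • C) * expPoly 3 ((1 / 2 : ℂ) • L)))) - expPoly 7 Θ ∈ F 7 := by
  have hB := (F 3).add_mem hC hL
  have hK : (1 / 12 : ℂ) • ⁅X, ⁅X, C + L⁆⁆ ∈ F 5 :=
    (F 5).smul_mem _ (hF.lie_mem hX (hF.lie_mem hX hB))
  refine (hasParts_symm hF hX ((F 3).smul_mem _ hC) ((F 3).smul_mem _ hL)).sub_mem
    ((hasParts_expPoly_theta hF hX hB hK hΘ).congr ?_)
  rw [← smul_add]
  generalize C + L = B
  -- The factor `1/12` is decided in weight five: `(XXB - 2XBX + BXX)/12` cancels `XBX` in `(XXB +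
  -- XBX + BXX)/6` and leaves the `(XXB + BXX)/4` of the splitting. The same factor then also fits
  -- weight six.
  refine forall_lt_seven.2 ⟨rfl, rfl, rfl, ?_, ?_, ?_, ?_⟩ <;>
    simp only [parts, Ring.lie_def, mul_sub, sub_mul, smul_sub, mul_smul_comm, smul_mul_assoc,
      pow_succ, pow_zero, one_mul, mul_assoc] <;> module

end Filtered

/-! ### Taylor expansion of unitary groups -/

section Taylor

variable {S E : Type*} [AddCommGroup S] [Module ℂ S] [NormedAddCommGroup E] [NormedSpace ℂ E]
  [NormedSpace ℝ E] [IsScalarTower ℝ ℂ E]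

/-- `U` is the value at time one of a one-parameter group of isometries of `E` whose generator
agrees with `A` on the image of `D` under `ι`. -/
def IsGroupExp (D : Submodule ℂ S) (ι : S →ₗ[ℂ] E) (A : Module.End ℂ S) (U : E ≃ₗᵢ[ℂ] E) : Prop :=
  ∃ G : ℝ → (E ≃ₗᵢ[ℂ] E), (∀ s t f, G (s + t) f = G s (G t f)) ∧
    (∀ v ∈ D, HasDerivAt (fun s => G s (ι v)) (ι (A v)) 0) ∧ U = G 1

variable {D : Submodule ℂ S} {ι : S →ₗ[ℂ] E} {A : Module.End ℂ S}

/-- Induction on `m`: the derivative in `s` of the remainder of order `m + 1` at `v` is the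
remainder of order `m` at `A v`, so the mean value inequality on `[0, 1]` applies. The base case is
the isometry property. The factor `1/m!` is given away. -/
theorem norm_group_sub_sum_le (hA : ∀ v ∈ D, A v ∈ D) {G : ℝ → (E ≃ₗᵢ[ℂ] E)}
    (hG : ∀ s t f, G (s + t) f = G s (G t f))
    (hG' : ∀ v ∈ D, HasDerivAt (fun s => G s (ι v)) (ι (A v)) 0) (m : ℕ) :
    ∀ v ∈ D, ∀ s ∈ Icc (0 : ℝ) 1,
      ‖G s (ι v) - ∑ k ∈ Finset.range m, ((s : ℂ) ^ k * (k.factorial : ℂ)⁻¹) • ι ((A ^ k) v)‖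
        ≤ ‖ι ((A ^ m) v)‖ := by
  have h0 : ∀ f, G 0 f = f := fun f => (G 0).injective (by rw [← hG, add_zero])
  -- The derivative at zero is transported to `s` by the group law `G r = G s ∘ G (r - s)`.
  have hd : ∀ v ∈ D, ∀ s, HasDerivAt (fun s => G s (ι v)) (G s (ι (A v))) s := fun v hv s => by
    have h1 := (G s).toContinuousLinearEquiv.toContinuousLinearMap.restrictScalars ℝ
      |>.hasFDerivAt.comp_hasDerivAt (0 : ℝ) (hG' v hv)
    have h2 : HasDerivAt (fun r : ℝ => r - s) 1 s := (hasDerivAt_id s).sub_const s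
    have h3 := HasDerivAt.scomp s (g₁ := fun r => G s (G r (ι v))) (h := fun r => r - s)
      (g₁' := G s (ι (A v))) (by rw [sub_self]; exact h1) h2
    rw [one_smul] at h3
    refine h3.congr_of_eventuallyEq (Filter.Eventually.of_forall fun r => ?_)
    change _ = G s (G (r - s) (ι v))
    rw [← hG, add_sub_cancel]
  induction m with
  | zero => intro v hv s _; simp
  | succ m ih =>
    intro v hv s hs
    set φ : ℝ → E := fun s => G s (ι v) - ∑ k ∈ Finset.range (m + 1),
      ((s : ℂ) ^ k * (k.factorial : ℂ)⁻¹) • ι ((A ^ k) v) with hφ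
    have hφ0 : φ 0 = 0 := by
      simp [hφ, h0, Finset.sum_range_succ']
    have hφ' : ∀ s, HasDerivAt φ (G s (ι (A v)) - ∑ k ∈ Finset.range m,
        ((s : ℂ) ^ k * (k.factorial : ℂ)⁻¹) • ι ((A ^ k) (A v))) s := fun s => by
      refine (hd v hv s).sub ?_
      have hk : ∀ k : ℕ, HasDerivAt (fun s : ℝ => ((s : ℂ) ^ k * (k.factorial : ℂ)⁻¹))
          ((k : ℂ) * (s : ℂ) ^ (k - 1) * (k.factorial : ℂ)⁻¹) s := fun k => by
        exact ((hasDerivAt_pow k (s : ℂ)).comp_ofReal).mul_const _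
      have hsum := HasDerivAt.fun_sum (u := Finset.range (m + 1))
        fun k _ => (hk k).smul_const (ι ((A ^ k) v))
      convert hsum using 1
      -- The term `k = 0` has derivative zero, so the truncated exponent `k - 1` does no harm there.
      rw [Finset.sum_range_succ']
      simp only [Nat.cast_zero, zero_mul, zero_smul, add_zero]
      refine Finset.sum_congr rfl fun k _ => ?_
      rw [pow_succ A k, Module.End.mul_apply]
      congr 1
      rw [Nat.factorial_succ, Nat.add_sub_cancel]
      have : ((k + 1 : ℕ) : ℂ) ≠ 0 := by exact_mod_cast k.succ_ne_zero
      have : (k.factorial : ℂ) ≠ 0 := by exact_mod_cast k.factorial_ne_zero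
      push_cast at *
      field_simp
    have := norm_image_sub_le_of_norm_deriv_le_segment' (a := 0) (b := 1)
      (fun x _ => (hφ' x).hasDerivWithinAt)
      (fun x hx => ih (A v) (hA v hv) x ⟨hx.1, hx.2.le⟩) s hs
    rw [hφ0, sub_zero, sub_zero] at this
    refine this.trans ?_
    rw [pow_succ A m, Module.End.mul_apply]
    exact mul_le_of_le_one_right (norm_nonneg _) hs.2

theorem IsGroupExp.norm_sub_expPoly_le {U : E ≃ₗᵢ[ℂ] E} (h : IsGroupExp D ι A U)
    (hA : ∀ v ∈ D, A v ∈ D) (m : ℕ) {v : S} (hv : v ∈ D) :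
    ‖U (ι v) - ι (expPoly m A v)‖ ≤ ‖ι ((A ^ m) v)‖ := by
  obtain ⟨G, hG, hG', rfl⟩ := h
  have := norm_group_sub_sum_le hA hG hG' m v hv 1 ⟨zero_le_one, le_rfl⟩
  simpa [expPoly, LinearMap.sum_apply, map_sum] using this

end Taylor

/-! ### Bounded families -/

section Families

variable {S : Type*} [AddCommGroup S] [Module ℂ S] {P : Type*}

/-- The families of vectors spanned by the products of a bounded scalar function and a fixed vector
of `D`. -/
def boundedFamilies (P : Type*) (D : Submodule ℂ S) : Submodule ℂ (P → S) :=
  Submodule.span ℂ {v | ∃ a : P → ℂ, (∃ M, ∀ p, ‖a p‖ ≤ M) ∧ ∃ w ∈ D, v = fun p => a p • w}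

variable {D : Submodule ℂ S}

theorem bounded_smul_mem {a : P → ℂ} {M : ℝ} (ha : ∀ p, ‖a p‖ ≤ M) {v : P → S}
    (hv : v ∈ boundedFamilies P D) : (fun p => a p • v p) ∈ boundedFamilies P D := by
  induction hv using Submodule.span_induction with
  | mem v hv =>
    obtain ⟨b, ⟨N, hb⟩, w, hw, rfl⟩ := hv
    refine Submodule.subset_span ⟨fun p => a p * b p, ⟨M * N, fun p => ?_⟩, w, hw, ?_⟩
    · rw [norm_mul]
      exact mul_le_mul (ha p) (hb p) (norm_nonneg _) ((norm_nonneg _).trans (ha p))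
    · exact funext fun p => smul_smul _ _ _
  | zero =>
    convert (boundedFamilies P D).zero_mem using 1
    exact funext fun p => smul_zero _
  | add v w _ _ hv hw =>
    convert (boundedFamilies P D).add_mem hv hw using 1
    exact funext fun p => smul_add _ _ _
  | smul c v _ hv =>
    have := (boundedFamilies P D).smul_mem c hv
    convert this using 1
    exact funext fun p => smul_comm _ _ _

theorem const_mem_boundedFamilies {w : S} (hw : w ∈ D) : (fun _ : P => w) ∈ boundedFamilies P D :=
  Submodule.subset_span ⟨fun _ => 1, ⟨1, fun _ => by simp⟩, w, hw, by simp⟩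

theorem apply_mem_of_mem_boundedFamilies {v : P → S} (hv : v ∈ boundedFamilies P D) (p : P) :
    v p ∈ D := by
  induction hv using Submodule.span_induction with
  | mem v hv => obtain ⟨b, _, w, hw, rfl⟩ := hv; exact D.smul_mem _ hw
  | zero => exact D.zero_mem
  | add v w _ _ hv hw => exact D.add_mem hv hw
  | smul c v _ hv => exact D.smul_mem c hv

/-- A bounded family involves only finitely many fixed vectors, so no continuity of `ι` and no
topology on `S` is needed. -/
theorem exists_norm_le_of_mem_boundedFamilies {E : Type*} [NormedAddCommGroup E] [NormedSpace ℂ E]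
    (ι : S →ₗ[ℂ] E) {v : P → S} (hv : v ∈ boundedFamilies P D) : ∃ C, ∀ p, ‖ι (v p)‖ ≤ C := by
  induction hv using Submodule.span_induction with
  | mem v hv =>
    obtain ⟨b, ⟨M, hb⟩, w, hw, rfl⟩ := hv
    refine ⟨M * ‖ι w‖, fun p => ?_⟩
    rw [map_smul, norm_smul]
    exact mul_le_mul_of_nonneg_right (hb p) (norm_nonneg _)
  | zero => exact ⟨0, fun p => by simp⟩
  | add v w _ _ hv hw =>
    obtain ⟨M, hM⟩ := hv
    obtain ⟨N, hN⟩ := hw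
    refine ⟨M + N, fun p => ?_⟩
    rw [Pi.add_apply, map_add]
    exact norm_add_le_of_le (hM p) (hN p)
  | smul c v _ hv =>
    obtain ⟨M, hM⟩ := hv
    refine ⟨‖c‖ * M, fun p => ?_⟩
    rw [Pi.smul_apply, map_smul, norm_smul]
    exact mul_le_mul_of_nonneg_left (hM p) (norm_nonneg _)

/-- The families of operators which are of order `h ^ k` on `D`. -/
def familyOrder (h : P → ℝ) (D : Submodule ℂ S) (k : ℕ) : Submodule ℂ (P → Module.End ℂ S) where
  carrier := {A | ∀ v ∈ boundedFamilies P D,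
    (fun p => ((h p : ℂ) ^ k)⁻¹ • A p (v p)) ∈ boundedFamilies P D}
  zero_mem' v _ := by
    convert (boundedFamilies P D).zero_mem using 1
    exact funext fun p => smul_zero _
  add_mem' {A B} hA hB v hv := by
    convert (boundedFamilies P D).add_mem (hA v hv) (hB v hv) using 1
    exact funext fun p => smul_add _ _ _
  smul_mem' c A hA v hv := by
    have := (boundedFamilies P D).smul_mem c (hA v hv)
    convert this using 1
    exact funext fun p => smul_comm _ _ _

variable {h : P → ℝ}

theorem const_mem_familyOrder {A : Module.End ℂ S} (hA : ∀ v ∈ D, A v ∈ D) :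
    (fun _ => A) ∈ familyOrder h D 0 := by
  intro v hv
  simp only [pow_zero, inv_one, one_smul]
  induction hv using Submodule.span_induction with
  | mem v hv =>
    obtain ⟨b, hb, w, hw, rfl⟩ := hv
    exact Submodule.subset_span ⟨b, hb, A w, hA w hw, funext fun p => map_smul _ _ _⟩
  | zero =>
    convert (boundedFamilies P D).zero_mem using 1
    exact funext fun p => map_zero A
  | add v w _ _ hv hw =>
    convert (boundedFamilies P D).add_mem hv hw using 1
    exact funext fun p => map_add A _ _
  | smul c v _ hv =>
    convert (boundedFamilies P D).smul_mem c hv using 1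
    exact funext fun p => map_smul A _ _

theorem smul_mem_familyOrder (hh : ∀ p, h p ∈ Ioc (0 : ℝ) 1) {a : P → ℂ} {M : ℝ} {j k : ℕ}
    (ha : ∀ p, ‖a p‖ ≤ M * h p ^ j) {A : P → Module.End ℂ S} (hA : A ∈ familyOrder h D k) :
    (fun p => a p • A p) ∈ familyOrder h D (j + k) := by
  intro v hv
  have := bounded_smul_mem (a := fun p => a p * ((h p : ℂ) ^ j)⁻¹) (M := M) (fun p => ?_) (hA v hv)
  · convert this using 1
    funext p
    rw [LinearMap.smul_apply, smul_smul, smul_smul, pow_add, mul_inv]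
    congr 1
    ring
  · have hp : 0 < h p ^ j := pow_pos (hh p).1 j
    rw [norm_mul, norm_inv, norm_pow, norm_real, Real.norm_of_nonneg (hh p).1.le,
      ← div_eq_mul_inv, div_le_iff₀ hp]
    exact ha p

/-- The filtration decreases because `h ≤ 1`, and it is multiplicative because the scalar `h⁻ʲ`
passes through the linear operator `A p`. -/
theorem isFiltration_familyOrder (hh : ∀ p, h p ∈ Ioc (0 : ℝ) 1) :
    IsFiltration (familyOrder h D) where
  one_mem := const_mem_familyOrder fun v hv => hv
  anti i j hij A hA v hv := by
    have := bounded_smul_mem (a := fun p => (h p : ℂ) ^ (j - i)) (M := 1) (fun p => ?_) (hA v hv)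
    · convert this using 1
      funext p
      have hp : (h p : ℂ) ≠ 0 := ofReal_ne_zero.2 (hh p).1.ne'
      obtain ⟨k, rfl⟩ := Nat.exists_eq_add_of_le hij
      rw [smul_smul, Nat.add_sub_cancel_left, pow_add]
      congr 1
      field_simp
    · rw [norm_pow, norm_real, Real.norm_of_nonneg (hh p).1.le]
      exact pow_le_one₀ (hh p).1.le (hh p).2
  mul_mem {i j A B} hA hB v hv := by
    have := hA _ (hB v hv)
    convert this using 1
    funext p
    rw [map_smul, smul_smul, pow_add, mul_inv]
    rfl

variable {A : P → Module.End ℂ S}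

theorem smul_inv_smul_pow (hh : ∀ p, h p ∈ Ioc (0 : ℝ) 1) (k : ℕ) (p : P) (x : S) :
    ((h p : ℂ) ^ k) • ((h p : ℂ) ^ k)⁻¹ • x = x :=
  smul_inv_smul₀ (pow_ne_zero k (ofReal_ne_zero.2 (hh p).1.ne')) x

theorem apply_mem_of_mem_familyOrder (hh : ∀ p, h p ∈ Ioc (0 : ℝ) 1) {k : ℕ}
    (hA : A ∈ familyOrder h D k) (p : P) (w : S) (hw : w ∈ D) : A p w ∈ D := by
  have := D.smul_mem ((h p : ℂ) ^ k)
    (apply_mem_of_mem_boundedFamilies (hA _ (const_mem_boundedFamilies hw)) p)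
  rwa [smul_inv_smul_pow hh] at this

variable {E : Type*} [NormedAddCommGroup E] [NormedSpace ℂ E]

theorem exists_norm_le_of_mem_familyOrder (hh : ∀ p, h p ∈ Ioc (0 : ℝ) 1) (ι : S →ₗ[ℂ] E) {k : ℕ}
    (hA : A ∈ familyOrder h D k) {v : P → S} (hv : v ∈ boundedFamilies P D) :
    ∃ C, ∀ p, ‖ι (A p (v p))‖ ≤ C * h p ^ k := by
  obtain ⟨C, hC⟩ := exists_norm_le_of_mem_boundedFamilies ι (hA v hv)
  refine ⟨C, fun p => ?_⟩
  rw [← smul_inv_smul_pow hh k p (A p (v p)), map_smul, norm_smul, norm_pow, norm_real,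
    Real.norm_of_nonneg (hh p).1.le, mul_comm]
  exact mul_le_mul_of_nonneg_right (hC p) (pow_nonneg (hh p).1.le k)

/-- One step of the telescoping estimate: an isometry carries along the error already made without
enlarging it. -/
theorem norm_sub_le_step (U : E ≃ₗᵢ[ℂ] E) {x y z : E} {a b : ℝ} (h₁ : ‖x - y‖ ≤ a)
    (h₂ : ‖U y - z‖ ≤ b) : ‖U x - z‖ ≤ a + b := by
  refine (norm_sub_le_norm_sub_add_norm_sub (U x) (U y) z).trans (add_le_add ?_ h₂)
  rwa [← map_sub, U.norm_map]

variable [NormedSpace ℝ E] [IsScalarTower ℝ ℂ E]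

theorem expPoly_apply (m : ℕ) (p : P) : expPoly m A p = expPoly m (A p) := by
  simp [expPoly]

theorem expPoly_mem (hh : ∀ p, h p ∈ Ioc (0 : ℝ) 1) {i : ℕ} (hA : A ∈ familyOrder h D i) (m : ℕ) :
    expPoly m A ∈ familyOrder h D 0 :=
  (familyOrder h D 0).sum_mem fun k _ => (familyOrder h D 0).smul_mem _
    ((isFiltration_familyOrder hh).anti (Nat.zero_le _)
      ((isFiltration_familyOrder hh).pow_mem hA k))

/-- If `A = O(h ^ i)` and `i * m ≥ 7`, the Taylor polynomial of degree less than `m` approximates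
the exponential of `A` on bounded families up to `O(h ^ 7)`. -/
theorem exists_norm_sub_expPoly_le (hh : ∀ p, h p ∈ Ioc (0 : ℝ) 1) (ι : S →ₗ[ℂ] E) {i m : ℕ}
    (him : 7 ≤ i * m) (hA : A ∈ familyOrder h D i) {B : P → Module.End ℂ S}
    (hB : B ∈ familyOrder h D 0) {w : S} (hw : w ∈ D) :
    ∃ C, ∀ p, ∀ U : E ≃ₗᵢ[ℂ] E, IsGroupExp D ι (A p) U →
      ‖U (ι (B p w)) - ι ((expPoly m A * B) p w)‖ ≤ C * h p ^ 7 := by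
  have hF := isFiltration_familyOrder (D := D) hh
  have hAB : A ^ m * B ∈ familyOrder h D (i * m + 0) := hF.mul_mem (hF.pow_mem hA m) hB
  obtain ⟨C, hC⟩ := exists_norm_le_of_mem_familyOrder hh ι
    (hF.anti (show 7 ≤ i * m + 0 from him) hAB) (const_mem_boundedFamilies hw)
  -- The constant is fixed before `U`, hence does not depend on the choice of the group.
  refine ⟨C, fun p U hU => ?_⟩
  rw [Pi.mul_apply, Module.End.mul_apply, expPoly_apply]
  exact ((hU.norm_sub_expPoly_le (apply_mem_of_mem_familyOrder hh hA p) m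
    (apply_mem_of_mem_familyOrder hh hB p w hw)).trans (hC p))

attribute [local irreducible] expPoly familyOrder in
/-- The symmetric splitting of unitary groups with unbounded generators has an error `O(h ^ 7)` on
`D` if the double commutator is included in the exponent. -/
theorem exists_norm_splitting_sub_le (hh : ∀ p, h p ∈ Ioc (0 : ℝ) 1) (ι : S →ₗ[ℂ] E)
    {X C L Θ : P → Module.End ℂ S} (hX : X ∈ familyOrder h D 1) (hC : C ∈ familyOrder h D 3)
    (hL : L ∈ familyOrder h D 3)
    (hΘ : Θ - (X + (C + L) + (1 / 12 : ℂ) • ⁅X, ⁅X, C + L⁆⁆) ∈ familyOrder h D 7)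
    {w : S} (hw : w ∈ D) :
    ∃ K, ∀ p, ∀ expL expC expX expΘ : E ≃ₗᵢ[ℂ] E,
      IsGroupExp D ι ((1 / 2 : ℂ) • L p) expL → IsGroupExp D ι ((1 / 2 : ℂ) • C p) expC →
      IsGroupExp D ι (X p) expX → IsGroupExp D ι (Θ p) expΘ →
      ‖expL (expC (expX (expC (expL (ι w))))) - expΘ (ι w)‖ ≤ K * h p ^ 7 := by
  have hF := isFiltration_familyOrder (D := D) hh
  have hL' := (familyOrder h D 3).smul_mem (1 / 2 : ℂ) hL
  have hC' := (familyOrder h D 3).smul_mem (1 / 2 : ℂ) hC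
  have hΘ1 : Θ ∈ familyOrder h D 1 :=
    hF.mem_one_of_sub_mem hX ((familyOrder h D 3).add_mem hC hL) hΘ
  have mL := expPoly_mem hh hL' 3
  have m2 := hF.mul_mem (expPoly_mem hh hC' 3) mL
  have m3 := hF.mul_mem (expPoly_mem hh hX 7) m2
  have m4 := hF.mul_mem (expPoly_mem hh hC' 3) m3
  -- The exponentials are replaced from the right, so each acts on a polynomial in the operators
  -- applied to `w`, which stays in `D`. Order three needs `m = 3` since `3 * 3 ≥ 7`; order one
  -- needs `m = 7`.
  obtain ⟨K₁, h₁⟩ := exists_norm_sub_expPoly_le (E := E) (m := 3) hh ι (by simp) hL' hF.one_mem hw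
  obtain ⟨K₂, h₂⟩ := exists_norm_sub_expPoly_le (E := E) (m := 3) hh ι (by simp) hC' mL hw
  obtain ⟨K₃, h₃⟩ := exists_norm_sub_expPoly_le (E := E) (m := 7) hh ι (by simp) hX m2 hw
  obtain ⟨K₄, h₄⟩ := exists_norm_sub_expPoly_le (E := E) (m := 3) hh ι (by simp) hC' m3 hw
  obtain ⟨K₅, h₅⟩ := exists_norm_sub_expPoly_le (E := E) (m := 3) hh ι (by simp) hL' m4 hw
  obtain ⟨K₆, h₆⟩ := exists_norm_sub_expPoly_le (E := E) (m := 7) hh ι (by simp) hΘ1 hF.one_mem hw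
  obtain ⟨K₇, h₇⟩ := exists_norm_le_of_mem_familyOrder hh ι (splitting_sub_mem hF hX hC hL hΘ)
    (const_mem_boundedFamilies hw)
  rw [mul_one] at h₁ h₆
  refine ⟨K₁ + K₂ + K₃ + K₄ + K₅ + K₇ + K₆, fun p expL expC expX expΘ hLp hCp hXp hΘp => ?_⟩
  have a₅ := norm_sub_le_step expL (norm_sub_le_step expC (norm_sub_le_step expX
    (norm_sub_le_step expC (h₁ p expL hLp) (h₂ p expC hCp)) (h₃ p expX hXp)) (h₄ p expC hCp))
    (h₅ p expL hLp)
  have a₆ := h₆ p expΘ hΘp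
  have a₇ := h₇ p
  rw [norm_sub_rev] at a₆
  rw [Pi.sub_apply, LinearMap.sub_apply, map_sub] at a₇
  rw [Pi.one_apply, Module.End.one_apply] at a₅ a₆
  have := norm_add_le_of_le (norm_add_le_of_le a₅ a₇) a₆
  rw [sub_add_sub_cancel, sub_add_sub_cancel] at this
  refine this.trans (le_of_eq ?_)
  ring

end Families

/-! ### Commutators of differential operators -/

section AlgebraCommutators

attribute [local instance] LieRing.ofAssociativeRing

variable {R : Type*} [Ring R]

theorem lie_one_right (A : R) : ⁅A, (1 : R)⁆ = 0 := by rw [Ring.lie_def, mul_one, one_mul, sub_self]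

variable [Algebra ℂ R]

/-- Leibniz rule `[d², l] = d[d, l] + [d, l]d` with `[d, l]` a scalar. -/
theorem lie_sum_mul_self {κ : Type*} [Fintype κ] (d : κ → R) (l : R) (c : κ → ℂ)
    (h : ∀ i, ⁅d i, l⁆ = c i • (1 : R)) : ⁅∑ i, d i * d i, l⁆ = (2 : ℂ) • ∑ i, c i • d i := by
  rw [Ring.lie_def, Finset.sum_mul, Finset.mul_sum, ← Finset.sum_sub_distrib, Finset.smul_sum]
  refine Finset.sum_congr rfl fun i _ => ?_
  have h' := h i
  rw [Ring.lie_def, sub_eq_iff_eq_add] at h'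
  rw [mul_assoc, h', mul_add, ← mul_assoc, h', add_mul, mul_smul_comm, smul_mul_assoc, mul_one,
    one_mul, mul_assoc]
  module

/-- The inner commutator is `2αδ dQ - βγ(GP + b)`. In the outer one, `dQ` meets only `V` and `GP`
meets only `Δ'`; all other brackets vanish. -/
theorem lie_lie_split {Δ' V Q dQ dP GQ GP : R} {a b : ℂ} (α β γ δ : ℂ)
    (hΔQ : ⁅Δ', Q⁆ = (2 : ℂ) • dQ) (hΔdQ : ⁅Δ', dQ⁆ = 0) (hΔdP : ⁅Δ', dP⁆ = 0) (hVQ : ⁅V, Q⁆ = 0)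
    (hVG : ⁅V, GP⁆ = 0) (hdQV : ⁅dQ, V⁆ = GQ + a • 1) (hdPV : ⁅dP, V⁆ = GP + b • 1) :
    ⁅α • Δ' - β • V, ⁅α • Δ' - β • V, -(γ • dP) + δ • Q⁆⁆ =
      (2 * (α * β) * δ) • (GQ + a • 1) + (-(α * β * γ)) • ⁅Δ', GP⁆ := by
  have hVdQ : ⁅V, dQ⁆ = -(GQ + a • 1) := by rw [← lie_skew, hdQV]
  have hVdP : ⁅V, dP⁆ = -(GP + b • 1) := by rw [← lie_skew, hdPV]
  simp only [sub_lie, lie_sub, lie_add, lie_neg, lie_smul, smul_lie, hVdQ, hVdP, hΔQ, hΔdQ, hΔdP,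
    hVQ, hVG, lie_one_right, lie_zero, smul_zero]
  module

theorem lie_sum_mul_self_eq_zero {κ : Type*} [Fintype κ] (d : κ → R) (l : R)
    (h : ∀ i, ⁅d i, l⁆ = 0) : ⁅∑ i, d i * d i, l⁆ = 0 := by
  have := lie_sum_mul_self d l 0 (by simpa using h)
  simpa using this

end AlgebraCommutators

section Commutators

attribute [local instance] LieRing.ofAssociativeRing

variable {n : ℕ}

theorem lie_dirOp_mulOp_apply (a : Space n) {f : Space n → ℝ} (hf : ContDiff ℝ ∞ f) (u : Smooth n)
    (x : Space n) : (⁅dirOp a, mulOp f hf⁆ u).1 x = (fderiv ℝ f x a : ℂ) * u.1 x := by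
  have hu : HasFDerivAt u.1 (fderiv ℝ u.1 x) x :=
    ((smooth_contDiff u).differentiable (by simp) x).hasFDerivAt
  have hf' : HasFDerivAt (fun x => (f x : ℂ)) (ofRealCLM.comp (fderiv ℝ f x)) x :=
    ofRealCLM.hasFDerivAt.comp x (hf.differentiable (by simp) x).hasFDerivAt
  change fderiv ℝ (fun x => (f x : ℂ) * u.1 x) x a - (f x : ℂ) * fderiv ℝ u.1 x a = _
  rw [(hf'.fun_mul hu).fderiv]
  simp
  ring

theorem lie_dirOp_mulOp (a : Space n) {V₀ : Space n → ℝ} (hV : ContDiff ℝ ∞ V₀) :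
    ⁅dirOp a, mulOp V₀ hV⁆ = gradOp V₀ hV a := by
  refine LinearMap.ext fun u => Subtype.ext (funext fun x => ?_)
  rw [lie_dirOp_mulOp_apply, ← inner_gradient_left, real_inner_comm]
  rfl

theorem lie_dirOp_linOp (a b : Space n) :
    ⁅dirOp a, linOp b⁆ = ((inner ℝ b a : ℝ) : ℂ) • (1 : Module.End ℂ (Smooth n)) := by
  refine LinearMap.ext fun u => Subtype.ext (funext fun x => ?_)
  rw [linOp, lie_dirOp_mulOp_apply]
  have : HasFDerivAt (fun x : Space n => inner ℝ b x) (innerSL ℝ b) x := (innerSL ℝ b).hasFDerivAt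
  rw [this.fderiv]
  rfl

theorem lie_mulOp_mulOp {f g : Space n → ℝ} (hf : ContDiff ℝ ∞ f) (hg : ContDiff ℝ ∞ g) :
    ⁅mulOp f hf, mulOp g hg⁆ = 0 :=
  LinearMap.ext fun u => Subtype.ext (funext fun x => by
    change (f x : ℂ) * (g x * u.1 x) - g x * (f x * u.1 x) = 0
    ring)

theorem dirOp_dirOp_apply (a b : Space n) (u : Smooth n) (x : Space n) :
    (dirOp a (dirOp b u)).1 x = fderiv ℝ (fderiv ℝ u.1) x a b := by
  have h : DifferentiableAt ℝ (fderiv ℝ u.1) x :=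
    ((smooth_contDiff u).fderiv_right (m := ∞) (by simp)).differentiable (by simp) x
  change fderiv ℝ (fun y => fderiv ℝ u.1 y b) x a = _
  rw [(h.hasFDerivAt.clm_apply (hasFDerivAt_const b x)).fderiv]
  simp

theorem lie_dirOp_dirOp (a b : Space n) : ⁅dirOp a, dirOp b⁆ = 0 := by
  refine LinearMap.ext fun u => Subtype.ext (funext fun x => ?_)
  change (dirOp a (dirOp b u)).1 x - (dirOp b (dirOp a u)).1 x = 0
  rw [dirOp_dirOp_apply, dirOp_dirOp_apply, sub_eq_zero]
  exact (((smooth_contDiff u).contDiffAt (x := x)).isSymmSndFDerivAt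
    (by rw [minSmoothness_of_isRCLikeNormedField]; exact WithTop.coe_le_coe.2 (le_top : (2 : ℕ∞) ≤ ⊤))).eq a b

theorem lapOp_eq_sum :
    lapOp n = ∑ i, dirOp (EuclideanSpace.basisFun (Fin n) ℝ i) *
      dirOp (EuclideanSpace.basisFun (Fin n) ℝ i) := by
  refine LinearMap.ext fun u => Subtype.ext (funext fun x => ?_)
  change Δ u.1 x = _
  rw [InnerProductSpace.laplacian_eq_iteratedFDeriv_orthonormalBasis u.1
    (EuclideanSpace.basisFun (Fin n) ℝ), LinearMap.sum_apply, Submodule.coe_sum, Finset.sum_apply]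
  refine Finset.sum_congr rfl fun i _ => ?_
  rw [Module.End.mul_apply, dirOp_dirOp_apply, iteratedFDeriv_two_apply]
  rfl

/-- Separates the varying coordinates of `a` from fixed operators, which is also the form in which
orders in `h` are read off. -/
theorem dirOp_eq_sum (a : Space n) :
    dirOp a = ∑ i, (a i : ℂ) • dirOp (EuclideanSpace.basisFun (Fin n) ℝ i) := by
  refine LinearMap.ext fun u => Subtype.ext (funext fun x => ?_)
  rw [LinearMap.sum_apply, Submodule.coe_sum, Finset.sum_apply]
  change fderiv ℝ u.1 x a = _
  conv_lhs => rw [← (EuclideanSpace.basisFun (Fin n) ℝ).sum_repr a, map_sum]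
  refine Finset.sum_congr rfl fun i _ => ?_
  rw [map_smul, EuclideanSpace.basisFun_repr]
  rfl

theorem linOp_eq_sum (a : Space n) :
    linOp a = ∑ i, (a i : ℂ) • linOp (EuclideanSpace.basisFun (Fin n) ℝ i) := by
  refine LinearMap.ext fun u => Subtype.ext (funext fun x => ?_)
  rw [LinearMap.sum_apply, Submodule.coe_sum, Finset.sum_apply]
  change ((inner ℝ a x : ℝ) : ℂ) * u.1 x = _
  conv_lhs => rw [← (EuclideanSpace.basisFun (Fin n) ℝ).sum_repr a, sum_inner]
  rw [ofReal_sum, Finset.sum_mul]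
  refine Finset.sum_congr rfl fun i _ => ?_
  rw [EuclideanSpace.basisFun_repr, real_inner_smul_left, ofReal_mul, mul_assoc]
  rfl

theorem dirOp_add (a b : Space n) : dirOp (a + b) = dirOp a + dirOp b :=
  LinearMap.ext fun u => Subtype.ext (funext fun x => map_add (fderiv ℝ u.1 x) a b)

theorem dirOp_smul (c : ℝ) (a : Space n) : dirOp (c • a) = (c : ℂ) • dirOp a :=
  LinearMap.ext fun u => Subtype.ext (funext fun x => map_smul (fderiv ℝ u.1 x) c a)

theorem lie_lapOp_dirOp (a : Space n) : ⁅lapOp n, dirOp a⁆ = 0 := by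
  rw [lapOp_eq_sum]
  exact lie_sum_mul_self_eq_zero (κ := Fin n) (R := Module.End ℂ (Smooth n)) _ _ fun i => lie_dirOp_dirOp _ a

theorem lie_lapOp_linOp (a : Space n) : ⁅lapOp n, linOp a⁆ = (2 : ℂ) • dirOp a := by
  rw [lapOp_eq_sum, dirOp_eq_sum a]
  refine lie_sum_mul_self (κ := Fin n) (R := Module.End ℂ (Smooth n)) _ _ _ fun i => ?_
  rw [lie_dirOp_linOp, EuclideanSpace.basisFun_apply, EuclideanSpace.inner_single_right]
  simp

variable (ε : ℝ) (V₀ : Space n → ℝ) (hV : ContDiff ℝ ∞ V₀) (e : ℝ → Space n) (t h : ℝ)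

/-- The part `ihεΔ - ihε⁻¹Ṽ` of the exponent of first order in `h`. -/
noncomputable def X0 : Module.End ℂ (Smooth n) :=
  (I * h * ε) • lapOp n - (I * h / ε) • vTildeOp V₀ hV e t h

/-- Two factors of `X0` contribute `(ihε)(ih/ε) = -h²`, which cancels the `h⁻²` in `C2` and `L3`;
their constants `-12` and `-6` make both results a multiple of `12`. The scalar `qᵀr` arises from
the part `rᵀx` of `Ṽ`. -/
theorem lie_X0_lie_X0 {ε h : ℝ} (hε : ε ≠ 0) (hh : h ≠ 0) :
    ⁅X0 ε V₀ hV e t h, ⁅X0 ε V₀ hV e t h, C2 e t h + L3 ε e t h⁆⁆ =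
      (12 * I / ε) • (gradOp V₀ hV (qVec e t h)
        + ((inner ℝ (qVec e t h) (rVec e t h) : ℝ) : ℂ) • 1)
        + (12 : ℂ) • ⁅lapOp n, gradOp V₀ hV (pVec e t h)⁆ := by
  have hV' : ∀ a : Space n, ⁅dirOp a, vTildeOp V₀ hV e t h⁆ =
      gradOp V₀ hV a + ((inner ℝ (rVec e t h) a : ℝ) : ℂ) • 1 := fun a => by
    rw [← lie_dirOp_mulOp, ← lie_dirOp_linOp]
    exact lie_add (dirOp a) (mulOp V₀ hV) (linOp (rVec e t h))
  have hmul : ∀ {f : Space n → ℝ} (hf : ContDiff ℝ ∞ f), ⁅vTildeOp V₀ hV e t h, mulOp f hf⁆ = 0 :=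
    fun hf => (add_lie (mulOp V₀ hV) (linOp (rVec e t h)) (mulOp _ hf)).trans (by
      rw [lie_mulOp_mulOp, zero_add]
      exact lie_mulOp_mulOp (contDiff_lin (rVec e t h)) hf)
  have hε' : (ε : ℂ) ≠ 0 := ofReal_ne_zero.2 hε
  have hh' : (h : ℂ) ≠ 0 := ofReal_ne_zero.2 hh
  have key := lie_lie_split (I * h * ε) (I * h / ε) ((12 / h ^ 2 : ℝ) : ℂ)
    (-(6 * I / (ε * h ^ 2))) (lie_lapOp_linOp (qVec e t h)) (lie_lapOp_dirOp (qVec e t h))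
    (lie_lapOp_dirOp (pVec e t h)) (hmul (contDiff_lin (qVec e t h)))
    (hmul (contDiff_dot_gradient hV (pVec e t h))) (hV' _) (hV' _)
  rw [C2, dirOp_smul]
  refine key.trans ?_
  have c0 : I * h * ε * (I * h / ε) = -h ^ 2 := by
    field_simp
    rw [I_sq]
  have c1 : 2 * (-(h : ℂ) ^ 2) * -(6 * I / (ε * h ^ 2)) = 12 * I / ε := by
    field_simp
    norm_num
  have c2 : -(h : ℂ) ^ 2 * ((12 / h ^ 2 : ℝ) : ℂ) = -12 := by
    push_cast
    field_simp
  rw [c0, c1, c2, real_inner_comm (rVec e t h), neg_neg]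
  rfl

theorem theta4_eq {ε h : ℝ} (hε : ε ≠ 0) (hh : h ≠ 0) :
    theta4 ε V₀ hV e t h = T2 ε e t h + W3 ε V₀ hV e t h + (C2 e t h + L3 ε e t h)
      + (1 / 12 : ℂ) • ⁅X0 ε V₀ hV e t h, ⁅X0 ε V₀ hV e t h, C2 e t h + L3 ε e t h⁆⁆ := by
  rw [lie_X0_lie_X0 V₀ hV e t hε hh]
  have hs : dirOp (sVec e t h) = dirOp (sTilde e t h) + dirOp ((12 / h ^ 2) • pVec e t h) := by
    rw [← dirOp_add, sTilde, sub_add_cancel]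
  rw [theta4, T2, W3, C2, hs, cTilde]
  module

end Commutators

/-! ### Size of the moments of the laser field -/

section Moments

/-- The affine part `a + ζ b` of `f` is annihilated by the kernel and may be subtracted for free.
Conditions `ha` and `hb` also hold when `a` or `b` is zero, which covers kernels with fewer
vanishing moments. -/
theorem norm_moment_le {E : Type*} [NormedAddCommGroup E] [NormedSpace ℝ E] [CompleteSpace E]
    {f : ℝ → E} {k : ℝ → ℝ} {a b : E} {h K M : ℝ} {m : ℕ} (hh : 0 ≤ h)
    (hf : ContinuousOn f (Icc 0 h)) (hk : Continuous k) (hK : ∀ ζ ∈ Icc 0 h, |k ζ| ≤ K)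
    (hM : 0 ≤ M) (hfM : ∀ ζ ∈ Icc 0 h, ‖f ζ - a - ζ • b‖ ≤ M * ζ ^ m)
    (ha : (∫ ζ in (0 : ℝ)..h, k ζ) • a = 0) (hb : (∫ ζ in (0 : ℝ)..h, k ζ * ζ) • b = 0) :
    ‖∫ ζ in (0 : ℝ)..h, k ζ • f ζ‖ ≤ M * K * h ^ (m + 1) := by
  have i₁ : IntervalIntegrable (fun ζ => k ζ • f ζ) volume 0 h :=
    (hk.continuousOn.smul (by rwa [uIcc_of_le hh])).intervalIntegrable
  have i₂ : IntervalIntegrable (fun ζ => k ζ • a) volume 0 h :=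
    (by fun_prop : Continuous fun ζ => k ζ • a).intervalIntegrable 0 h
  have i₃ : IntervalIntegrable (fun ζ => (k ζ * ζ) • b) volume 0 h :=
    (by fun_prop : Continuous fun ζ => (k ζ * ζ) • b).intervalIntegrable 0 h
  have e : ∫ ζ in (0 : ℝ)..h, k ζ • f ζ = ∫ ζ in (0 : ℝ)..h, k ζ • (f ζ - a - ζ • b) := by
    rw [intervalIntegral.integral_congr (g := fun ζ => k ζ • f ζ - k ζ • a - (k ζ * ζ) • b)
      (f := fun ζ => k ζ • (f ζ - a - ζ • b)) fun ζ _ => by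
        simp only [smul_sub, smul_smul],
      intervalIntegral.integral_sub (i₁.sub i₂) i₃, intervalIntegral.integral_sub i₁ i₂,
      intervalIntegral.integral_smul_const, intervalIntegral.integral_smul_const, ha, hb]
    simp
  rw [e]
  have := intervalIntegral.norm_integral_le_of_norm_le_const (a := 0) (b := h)
    (f := fun ζ => k ζ • (f ζ - a - ζ • b)) (C := K * (M * h ^ m)) fun ζ hζ => by
      rw [uIoc_of_le hh] at hζ
      have hζ' : ζ ∈ Icc 0 h := ⟨hζ.1.le, hζ.2⟩
      rw [norm_smul, Real.norm_eq_abs]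
      refine mul_le_mul (hK ζ hζ') ((hfM ζ hζ').trans ?_) (norm_nonneg _)
        ((abs_nonneg _).trans (hK ζ hζ'))
      exact mul_le_mul_of_nonneg_left (pow_le_pow_left₀ hζ.1.le hζ.2 m) hM
  refine this.trans (le_of_eq ?_)
  rw [sub_zero, abs_of_nonneg hh]
  ring

/-- A uniform Taylor expansion of a twice continuously differentiable curve. -/
theorem exists_taylor_bound {E : Type*} [NormedAddCommGroup E] [NormedSpace ℝ E] {e : ℝ → E}
    (he : ContDiffOn ℝ 2 e (Ici 0)) (T : ℝ) :
    ∃ M : ℝ, 0 ≤ M ∧ ∃ e₁ : ℝ → E, ∀ t ∈ Icc 0 T, ∀ ζ ∈ Icc (0 : ℝ) 1, ‖e (t + ζ)‖ ≤ M ∧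
      ‖e (t + ζ) - e t‖ ≤ M * ζ ∧ ‖e (t + ζ) - e t - ζ • e₁ t‖ ≤ M * ζ ^ 2 := by
  have hu : UniqueDiffOn ℝ (Ici (0 : ℝ)) := uniqueDiffOn_Ici 0
  set e₁ := derivWithin e (Ici 0) with he₁
  have h1 : ContDiffOn ℝ 1 e₁ (Ici 0) := he.derivWithin hu (by norm_num)
  have h2 : ContDiffOn ℝ 0 (derivWithin e₁ (Ici 0)) (Ici 0) := h1.derivWithin hu (by norm_num)
  -- All arguments `t + ζ` with `t ≤ T` and `ζ ≤ 1` lie in this compact interval.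
  have hsub : Icc (0 : ℝ) (T + 1) ⊆ Ici 0 := fun x hx => hx.1
  obtain ⟨M₀, hM₀⟩ := isCompact_Icc.exists_bound_of_continuousOn (he.continuousOn.mono hsub)
  obtain ⟨M₁, hM₁⟩ := isCompact_Icc.exists_bound_of_continuousOn (h1.continuousOn.mono hsub)
  obtain ⟨M₂, hM₂⟩ := isCompact_Icc.exists_bound_of_continuousOn (h2.continuousOn.mono hsub)
  have hd : ∀ {g : ℝ → E}, DifferentiableOn ℝ g (Ici 0) → ∀ t, 0 ≤ t → ∀ δ, ∀ ζ ∈ Icc 0 δ,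
      HasDerivWithinAt (fun ζ => g (t + ζ)) (derivWithin g (Ici 0) (t + ζ)) (Icc 0 δ) ζ :=
    fun {g} hg t ht δ ζ hζ => by
      have := (hg (t + ζ) (add_nonneg ht hζ.1)).hasDerivWithinAt
      have h3 := this.scomp ζ (h := fun ζ => t + ζ) (s := Icc 0 δ)
        ((hasDerivWithinAt_id ζ _).const_add t) fun x hx => add_nonneg ht hx.1
      rw [one_smul] at h3
      exact h3
  have hlip : ∀ {g : ℝ → E} {N : ℝ}, DifferentiableOn ℝ g (Ici 0) →
      (∀ x ∈ Icc 0 (T + 1), ‖derivWithin g (Ici 0) x‖ ≤ N) → ∀ t ∈ Icc 0 T, ∀ ζ ∈ Icc (0 : ℝ) 1,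
      ‖g (t + ζ) - g t‖ ≤ N * ζ := fun {g N} hg hN t ht ζ hζ => by
    have := norm_image_sub_le_of_norm_deriv_le_segment' (hd hg t ht.1 1)
      (fun x hx => hN (t + x) ⟨add_nonneg ht.1 hx.1, add_le_add ht.2 hx.2.le⟩) ζ hζ
    simpa using this
  have d0 : DifferentiableOn ℝ e (Ici 0) := he.differentiableOn (by norm_num)
  have d1 : DifferentiableOn ℝ e₁ (Ici 0) := h1.differentiableOn (by norm_num)
  set M := max 0 (max M₀ (max M₁ M₂)) with hM
  have m0 : M₀ ≤ M := by simp [hM]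
  have m1 : M₁ ≤ M := by simp [hM]
  have m2 : M₂ ≤ M := by simp [hM]
  have l1 := hlip d1 fun x hx => (hM₂ x hx).trans m2
  refine ⟨M, le_max_left _ _, e₁, fun t ht ζ hζ => ⟨(hM₀ _ ⟨add_nonneg ht.1 hζ.1,
    add_le_add ht.2 hζ.2⟩).trans m0, hlip d0 (fun x hx => (hM₁ x hx).trans m1) t ht ζ hζ, ?_⟩⟩
  -- The second-order remainder: its derivative `e₁ (t + x) - e₁ t` is at most `M ζ` by the
  -- Lipschitz bound for `e₁`.
  have hφ : ∀ x ∈ Icc 0 ζ, HasDerivWithinAt (fun x => e (t + x) - x • e₁ t)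
      (e₁ (t + x) - e₁ t) (Icc 0 ζ) x := fun x hx => by
    have := (hd d0 t ht.1 ζ x hx).sub ((hasDerivWithinAt_id x (Icc 0 ζ)).smul_const (e₁ t))
    rw [one_smul] at this
    exact this
  have := norm_image_sub_le_of_norm_deriv_le_segment' hφ
    (fun x hx => (l1 t ht x ⟨hx.1, hx.2.le.trans hζ.2⟩).trans
      (mul_le_mul_of_nonneg_left hx.2.le (le_max_left _ _))) ζ ⟨hζ.1, le_rfl⟩
  simp only [add_zero, zero_smul, sub_zero] at this
  rw [sub_right_comm, pow_two, ← mul_assoc]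
  exact this

theorem integral_cubic (a b c d h : ℝ) :
    ∫ ζ in (0 : ℝ)..h, (a * ζ ^ 3 + b * ζ ^ 2 + c * ζ + d) =
      a * (h ^ 4 / 4) + b * (h ^ 3 / 3) + c * (h ^ 2 / 2) + d * h := by
  rw [intervalIntegral.integral_eq_sub_of_hasDerivAt
    (f := fun ζ => a * (ζ ^ 4 / 4) + b * (ζ ^ 3 / 3) + c * (ζ ^ 2 / 2) + d * ζ) (fun x _ => ?_)
    (Continuous.intervalIntegrable (by fun_prop) _ _)]
  · ring
  · have := (((((hasDerivAt_pow 4 x).div_const 4).const_mul a).fun_add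
      (((hasDerivAt_pow 3 x).div_const 3).const_mul b)).fun_add
      (((hasDerivAt_pow 2 x).div_const 2).const_mul c)).fun_add ((hasDerivAt_id' x).const_mul d)
    refine this.congr_deriv ?_
    push_cast
    ring

variable {n : ℕ} {e : ℝ → Space n}

/-- The orders in `h` of the moments of the laser field and of the scalar `c`. -/
theorem exists_moment_bounds (he : ContDiffOn ℝ 2 e (Ici 0)) (T ε : ℝ) :
    ∃ M : ℝ, ∀ t ∈ Icc 0 T, ∀ h ∈ Ioc (0 : ℝ) 1, ‖rVec e t h‖ ≤ M ∧ ‖sVec e t h‖ ≤ M * h ^ 3 ∧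
      ‖qVec e t h‖ ≤ M * h ^ 5 ∧ ‖pVec e t h‖ ≤ M * h ^ 5 ∧ ‖cScalar ε e t h‖ ≤ M * h := by
  obtain ⟨M, hM, e₁, H⟩ := exists_taylor_bound he T
  -- The `2` is the prefactor of `s`; the `4` dominates the weights `2 + 1 + 1/6` of the three terms
  -- of `c`.
  refine ⟨max (2 * M) (4 * M ^ 2 * |ε|⁻¹), fun t ht h hh => ?_⟩
  have hh0 := hh.1.le
  have hI : ∀ ζ ∈ Icc 0 h, ζ ∈ Icc (0 : ℝ) 1 := fun ζ hζ => ⟨hζ.1, hζ.2.trans hh.2⟩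
  have hc : ContinuousOn (fun ζ => e (t + ζ)) (Icc 0 h) :=
    he.continuousOn.comp (by fun_prop) fun ζ hζ => add_nonneg ht.1 hζ.1
  have B₀ : ∀ ζ ∈ Icc 0 h, ‖e (t + ζ) - 0 - ζ • (0 : Space n)‖ ≤ M * ζ ^ 0 := fun ζ hζ => by
    simpa using (H t ht ζ (hI ζ hζ)).1
  have B₁ : ∀ ζ ∈ Icc 0 h, ‖e (t + ζ) - e t - ζ • (0 : Space n)‖ ≤ M * ζ ^ 1 := fun ζ hζ => by
    simpa using (H t ht ζ (hI ζ hζ)).2.1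
  have B₂ : ∀ ζ ∈ Icc 0 h, ‖e (t + ζ) - e t - ζ • e₁ t‖ ≤ M * ζ ^ 2 := fun ζ hζ =>
    (H t ht ζ (hI ζ hζ)).2.2
  have hr : ‖∫ ζ in (0 : ℝ)..h, e (t + ζ)‖ ≤ M * h := by
    have := norm_moment_le (k := fun _ => 1) (K := 1) hh0 hc continuous_const (by simp) hM B₀
      (by simp) (by simp)
    simpa using this
  have hr' : ‖∫ ζ in (0 : ℝ)..h, ζ • e (t + ζ)‖ ≤ M * h := by
    have := norm_moment_le (k := fun ζ => ζ) (K := 1) hh0 hc continuous_id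
      (fun ζ hζ => by rw [abs_of_nonneg hζ.1]; exact hζ.2.trans hh.2) hM B₀ (by simp) (by simp)
    simpa using this
  have hs : ‖∫ ζ in (0 : ℝ)..h, (ζ - h / 2) • e (t + ζ)‖ ≤ M * h * h ^ (1 + 1) := by
    refine norm_moment_le (k := fun ζ => ζ - h / 2) hh0 hc (by fun_prop) (fun ζ hζ => ?_) hM B₁ ?_
      (by simp)
    · rw [abs_le]; constructor <;> linarith [hζ.1, hζ.2]
    · have : ∫ ζ in (0 : ℝ)..h, (ζ - h / 2) = 0 := by
        rw [intervalIntegral.integral_sub (by simp) (by simp)]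
        simp
        ring
      rw [this, zero_smul]
  -- The kernel has size `h²` and is orthogonal to affine functions, which gives `h² · h³`.
  have hq : ‖qVec e t h‖ ≤ M * h ^ 2 * h ^ (2 + 1) := by
    refine norm_moment_le (k := fun ζ => ζ ^ 2 - h * ζ + h ^ 2 / 6) hh0 hc (by fun_prop)
      (fun ζ hζ => ?_) hM B₂ ?_ ?_
    · have h1 : 0 ≤ ζ * (h - ζ) := mul_nonneg hζ.1 (sub_nonneg.2 hζ.2)
      rw [abs_le]; constructor <;> nlinarith [sq_nonneg (ζ - h / 2)]
    · have : ∫ ζ in (0 : ℝ)..h, (ζ ^ 2 - h * ζ + h ^ 2 / 6) = 0 := by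
        refine (intervalIntegral.integral_congr fun ζ _ => ?_).trans
          ((integral_cubic 0 1 (-h) (h ^ 2 / 6) h).trans (by ring))
        ring
      rw [this, zero_smul]
    · have : ∫ ζ in (0 : ℝ)..h, (ζ ^ 2 - h * ζ + h ^ 2 / 6) * ζ = 0 := by
        refine (intervalIntegral.integral_congr fun ζ _ => ?_).trans
          ((integral_cubic 1 (-h) (h ^ 2 / 6) 0 h).trans (by ring))
        ring
      rw [this, zero_smul]
  -- The kernel `ζ(ζ - h/2)(ζ - h)` has size `h³`, so orthogonality to constants is enough for order
  -- five.
  have hp : ‖∫ ζ in (0 : ℝ)..h, (ζ ^ 3 - 3 / 2 * h * ζ ^ 2 + 1 / 2 * h ^ 2 * ζ) • e (t + ζ)‖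
      ≤ M * h ^ 3 * h ^ (1 + 1) := by
    refine norm_moment_le (k := fun ζ => ζ ^ 3 - 3 / 2 * h * ζ ^ 2 + 1 / 2 * h ^ 2 * ζ) hh0 hc
      (by fun_prop) (fun ζ hζ => ?_) hM B₁ ?_ (by simp)
    · have e1 : ζ ^ 3 - 3 / 2 * h * ζ ^ 2 + 1 / 2 * h ^ 2 * ζ = ζ * (ζ - h / 2) * (ζ - h) := by ring
      rw [e1, abs_mul, abs_mul, show h ^ 3 = h * h * h by ring]
      have a1 : |ζ| ≤ h := by rw [abs_of_nonneg hζ.1]; exact hζ.2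
      have a2 : |ζ - h / 2| ≤ h := by rw [abs_le]; constructor <;> linarith [hζ.1, hζ.2]
      have a3 : |ζ - h| ≤ h := by rw [abs_le]; constructor <;> linarith [hζ.1, hζ.2]
      gcongr
    · have : ∫ ζ in (0 : ℝ)..h, (ζ ^ 3 - 3 / 2 * h * ζ ^ 2 + 1 / 2 * h ^ 2 * ζ) = 0 := by
        refine (intervalIntegral.integral_congr fun ζ _ => ?_).trans
          ((integral_cubic 1 (-(3 / 2 * h)) (1 / 2 * h ^ 2) 0 h).trans (by ring))
        ring
      rw [this, zero_smul]
  have m1 : 2 * M ≤ max (2 * M) (4 * M ^ 2 * |ε|⁻¹) := le_max_left _ _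
  have m2 : 4 * M ^ 2 * |ε|⁻¹ ≤ max (2 * M) (4 * M ^ 2 * |ε|⁻¹) := le_max_right _ _
  have m0 : M ≤ max (2 * M) (4 * M ^ 2 * |ε|⁻¹) := by linarith
  refine ⟨?_, ?_, ?_, ?_, ?_⟩
  · rw [rVec, norm_smul, norm_inv, Real.norm_of_nonneg hh0, inv_mul_le_iff₀ hh.1, mul_comm]
    exact hr.trans (mul_le_mul_of_nonneg_right m0 hh0)
  · rw [sVec, norm_smul, Real.norm_of_nonneg zero_le_two]
    calc 2 * _ ≤ 2 * (M * h * h ^ (1 + 1)) := by gcongr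
      _ = (2 * M) * h ^ 3 := by ring
      _ ≤ _ := by gcongr
  · calc _ ≤ M * h ^ 2 * h ^ (2 + 1) := hq
      _ = M * h ^ 5 := by ring
      _ ≤ _ := by gcongr
  · rw [pVec, norm_smul, Real.norm_of_nonneg (by norm_num)]
    calc 1 / 3 * _ ≤ 1 * (M * h ^ 3 * h ^ (1 + 1)) := by gcongr; norm_num
      _ = M * h ^ 5 := by ring
      _ ≤ _ := by gcongr
  -- A crude `O(h)` suffices for `c`: as a scalar it commutes with everything and only has to keep
  -- `X` of order one.
  · have c1 : |∫ ζ in (0 : ℝ)..h, ζ * inner ℝ (e (t + ζ)) (∫ ξ in (0 : ℝ)..ζ, e (t + ξ))|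
        ≤ 1 * (M * M) * |h - 0| := by
      rw [← Real.norm_eq_abs]
      refine intervalIntegral.norm_integral_le_of_norm_le_const fun ζ hζ => ?_
      rw [uIoc_of_le hh0] at hζ
      have hζ' := hI ζ ⟨hζ.1.le, hζ.2⟩
      have : ‖∫ ξ in (0 : ℝ)..ζ, e (t + ξ)‖ ≤ M * |ζ - 0| :=
        intervalIntegral.norm_integral_le_of_norm_le_const fun ξ hξ => by
          rw [uIoc_of_le hζ.1.le] at hξ
          exact (H t ht ξ ⟨hξ.1.le, hξ.2.trans hζ'.2⟩).1
      have h2 : M * |ζ - 0| ≤ M := by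
        rw [sub_zero, abs_of_nonneg hζ.1.le]
        exact mul_le_of_le_one_right hM hζ'.2
      rw [norm_mul, Real.norm_of_nonneg hζ.1.le]
      exact mul_le_mul hζ'.2 ((norm_inner_le_norm _ _).trans (mul_le_mul (H t ht ζ hζ').1
        (this.trans h2) (norm_nonneg _) hM)) (norm_nonneg _) zero_le_one
    rw [sub_zero, abs_of_nonneg hh0, one_mul] at c1
    have c2 := (abs_real_inner_le_norm (∫ ζ in (0 : ℝ)..h, e (t + ζ))
      (∫ ζ in (0 : ℝ)..h, ζ • e (t + ζ))).trans (mul_le_mul hr hr' (norm_nonneg _) (by positivity))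
    have c3 := pow_le_pow_left₀ (norm_nonneg _) hr 2
    have hM2 : 0 ≤ M ^ 2 := sq_nonneg M
    have hsq : M ^ 2 * (h * h) ≤ M ^ 2 * h := by
      gcongr
      exact mul_le_of_le_one_left hh0 hh.2
    rw [cScalar, norm_mul, norm_div, norm_I, norm_real, norm_real, Real.norm_eq_abs,
      Real.norm_eq_abs, one_div]
    have c4 : |2 * (∫ ζ in (0 : ℝ)..h, ζ * inner ℝ (e (t + ζ)) (∫ ξ in (0 : ℝ)..ζ, e (t + ξ)))
        - inner ℝ (∫ ζ in (0 : ℝ)..h, e (t + ζ)) (∫ ζ in (0 : ℝ)..h, ζ • e (t + ζ))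
        - 1 / 6 * h * ‖∫ ζ in (0 : ℝ)..h, e (t + ζ)‖ ^ 2| ≤ 4 * M ^ 2 * h := by
      have c5 : h * ‖∫ ζ in (0 : ℝ)..h, e (t + ζ)‖ ^ 2 ≤ M ^ 2 * h := by
        calc h * ‖∫ ζ in (0 : ℝ)..h, e (t + ζ)‖ ^ 2 ≤ 1 * (M * h) ^ 2 := by gcongr; exact hh.2
          _ = M ^ 2 * (h * h) := by ring
          _ ≤ _ := hsq
      have c6 : 0 ≤ h * ‖∫ ζ in (0 : ℝ)..h, e (t + ζ)‖ ^ 2 := by positivity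
      rw [abs_le] at c1 c2 ⊢
      constructor <;> nlinarith
    calc |ε|⁻¹ * _ ≤ |ε|⁻¹ * (4 * M ^ 2 * h) := by gcongr
      _ = 4 * M ^ 2 * |ε|⁻¹ * h := by ring
      _ ≤ _ := by gcongr

end Moments

/-! ### The exponents as families of operators -/

section Exponents

/-- The central `Z` drops out, and every remaining term contains a `Y`, hence has order at least `1
+ 3 + 3 = 7`. -/
theorem IsFiltration.lie_lie_sub_mem {R : Type*} [Ring R] [Algebra ℂ R] {F : ℕ → Submodule ℂ R}
    (hF : IsFiltration F) {X Y Z B : R} (hX : X ∈ F 1) (hY : Y ∈ F 3) (hB : B ∈ F 3)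
    (hZ : ∀ A : R, ⁅Z, A⁆ = 0) :
    ⁅X, ⁅X, B⁆⁆ - ⁅X + Y + Z, ⁅X + Y + Z, B⁆⁆ ∈ F 7 := by
  have hZ' : ∀ A : R, ⁅X + Y + Z, A⁆ = ⁅X, A⁆ + ⁅Y, A⁆ := fun A => by
    have := hZ A
    rw [Ring.lie_def, sub_eq_zero] at this
    simp only [Ring.lie_def, add_mul, mul_add, this]
    abel
  have e : ⁅X, ⁅X, B⁆⁆ - ⁅X + Y + Z, ⁅X + Y + Z, B⁆⁆ =
      -(⁅X, ⁅Y, B⁆⁆ + (⁅Y, ⁅X, B⁆⁆ + ⁅Y, ⁅Y, B⁆⁆)) := by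
    rw [hZ', hZ']
    simp only [Ring.lie_def]
    noncomm_ring
  rw [e]
  exact (F 7).neg_mem ((F 7).add_mem (hF.lie_mem hX (hF.lie_mem hY hB))
    ((F 7).add_mem (hF.lie_mem hY (hF.lie_mem hX hB))
      (hF.anti (show 7 ≤ 9 by omega) (hF.lie_mem hY (hF.lie_mem hY hB)))))

theorem IsFiltration.exponent_sub_mem {R : Type*} [Ring R] [Algebra ℂ R] {F : ℕ → Submodule ℂ R}
    (hF : IsFiltration F) {X₀ X Y Z B Θ : R} (hX₀ : X₀ ∈ F 1) (hY : Y ∈ F 3) (hB : B ∈ F 3)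
    (hZ : ∀ A : R, ⁅Z, A⁆ = 0) (hX : X = X₀ + Y + Z)
    (hΘ : Θ = X + B + (1 / 12 : ℂ) • ⁅X₀, ⁅X₀, B⁆⁆) :
    Θ - (X + B + (1 / 12 : ℂ) • ⁅X, ⁅X, B⁆⁆) ∈ F 7 := by
  rw [hΘ, add_sub_add_left_eq_sub, ← smul_sub, hX]
  exact (F 7).smul_mem _ (hF.lie_lie_sub_mem hX₀ hY hB hZ)

variable {n : ℕ} {V₀ : Space n → ℝ} {hV : ContDiff ℝ ∞ V₀} {D : Submodule ℂ (Smooth n)}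

theorem linOp_smul (c : ℝ) (a : Space n) : linOp (c • a) = (c : ℂ) • linOp a :=
  LinearMap.ext fun u => Subtype.ext (funext fun x => by
    change ((inner ℝ (c • a) x : ℝ) : ℂ) * u.1 x = (c : ℂ) * (((inner ℝ a x : ℝ) : ℂ) * u.1 x)
    rw [real_inner_smul_left, ofReal_mul, mul_assoc])

theorem IsTestSpace.lap_mem (hD : IsTestSpace V₀ hV D) : ∀ u ∈ D, lapOp n u ∈ D := fun u hu => by
  rw [lapOp_eq_sum, LinearMap.sum_apply]
  exact D.sum_mem fun i _ => hD.dir_mem _ _ (hD.dir_mem _ _ hu)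

variable {P : Type*} {h : P → ℝ}

theorem sum_smul_mem_familyOrder (hh : ∀ p, h p ∈ Ioc (0 : ℝ) 1)
    {A : Fin n → Module.End ℂ (Smooth n)} (hA : ∀ i, ∀ u ∈ D, A i u ∈ D) {a : P → Space n} {M : ℝ}
    {k : ℕ} (ha : ∀ p, ‖a p‖ ≤ M * h p ^ k) :
    (fun p => ∑ i, (a p i : ℂ) • A i) ∈ familyOrder h D k := by
  have e : (fun p => ∑ i, (a p i : ℂ) • A i) = ∑ i, fun p => (a p i : ℂ) • A i := by
    funext p
    rw [Finset.sum_apply]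
  rw [e]
  refine (familyOrder h D k).sum_mem fun i _ => ?_
  refine smul_mem_familyOrder (k := 0) hh (M := M) (fun p => ?_) (const_mem_familyOrder (hA i))
  rw [norm_real]
  exact (PiLp.norm_apply_le (a p) i).trans (ha p)

theorem dirOp_mem_familyOrder (hD : IsTestSpace V₀ hV D) (hh : ∀ p, h p ∈ Ioc (0 : ℝ) 1)
    {a : P → Space n} {M : ℝ} {k : ℕ} (ha : ∀ p, ‖a p‖ ≤ M * h p ^ k) :
    (fun p => dirOp (a p)) ∈ familyOrder h D k := by
  rw [funext fun p => dirOp_eq_sum (a p)]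
  exact sum_smul_mem_familyOrder hh (fun i => hD.dir_mem _) ha

theorem linOp_mem_familyOrder (hD : IsTestSpace V₀ hV D) (hh : ∀ p, h p ∈ Ioc (0 : ℝ) 1)
    {a : P → Space n} {M : ℝ} {k : ℕ} (ha : ∀ p, ‖a p‖ ≤ M * h p ^ k) :
    (fun p => linOp (a p)) ∈ familyOrder h D k := by
  rw [funext fun p => linOp_eq_sum (a p)]
  exact sum_smul_mem_familyOrder hh (fun i => hD.lin_mem _) ha

theorem norm_div_sq_smul_le {h M : ℝ} (hh : 0 < h) {v : Space n} (hv : ‖v‖ ≤ M * h ^ 5) (c : ℝ)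
    (hc : 0 ≤ c) : ‖(c / h ^ 2) • v‖ ≤ c * M * h ^ 3 := by
  rw [norm_smul, Real.norm_of_nonneg (by positivity), div_mul_eq_mul_div, div_le_iff₀ (by positivity)]
  calc c * ‖v‖ ≤ c * (M * h ^ 5) := by gcongr
    _ = _ := by ring

variable {ε M : ℝ} {e : ℝ → Space n} {t : P → ℝ}

theorem C2_mem_familyOrder (hD : IsTestSpace V₀ hV D) (hh : ∀ p, h p ∈ Ioc (0 : ℝ) 1)
    (hp : ∀ p, ‖pVec e (t p) (h p)‖ ≤ M * h p ^ 5) :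
    (fun p => C2 e (t p) (h p)) ∈ familyOrder h D 3 :=
  (isFiltration_familyOrder hh).neg_mem (dirOp_mem_familyOrder hD hh fun p =>
    norm_div_sq_smul_le (hh p).1 (hp p) 12 (by norm_num))

theorem L3_mem_familyOrder (hD : IsTestSpace V₀ hV D) (hh : ∀ p, h p ∈ Ioc (0 : ℝ) 1)
    (hq : ∀ p, ‖qVec e (t p) (h p)‖ ≤ M * h p ^ 5) :
    (fun p => L3 ε e (t p) (h p)) ∈ familyOrder h D 3 := by
  have := (familyOrder h D 3).smul_mem (-(6 * I / ε)) (linOp_mem_familyOrder hD hh fun p =>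
    norm_div_sq_smul_le (hh p).1 (hq p) 1 zero_le_one)
  convert this using 1
  funext p
  rw [Pi.smul_apply, linOp_smul, L3, smul_smul]
  congr 1
  push_cast
  ring

theorem dirOp_sTilde_mem_familyOrder (hD : IsTestSpace V₀ hV D) (hh : ∀ p, h p ∈ Ioc (0 : ℝ) 1)
    (hs : ∀ p, ‖sVec e (t p) (h p)‖ ≤ M * h p ^ 3)
    (hp : ∀ p, ‖pVec e (t p) (h p)‖ ≤ M * h p ^ 5) :
    (fun p => dirOp (sTilde e (t p) (h p))) ∈ familyOrder h D 3 := by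
  refine dirOp_mem_familyOrder (M := M + 12 * M) hD hh fun p => ?_
  rw [add_mul]
  exact norm_sub_le_of_le (hs p) (norm_div_sq_smul_le (hh p).1 (hp p) 12 (by norm_num))

theorem X0_mem_familyOrder (hD : IsTestSpace V₀ hV D) (hh : ∀ p, h p ∈ Ioc (0 : ℝ) 1)
    (hr : ∀ p, ‖rVec e (t p) (h p)‖ ≤ M) :
    (fun p => X0 ε V₀ hV e (t p) (h p)) ∈ familyOrder h D 1 := by
  have hv : (fun p => vTildeOp V₀ hV e (t p) (h p)) ∈ familyOrder h D 0 :=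
    (familyOrder h D 0).add_mem (const_mem_familyOrder hD.pot_mem)
      (linOp_mem_familyOrder (M := M) hD hh (by simpa using hr))
  refine (isFiltration_familyOrder hh).sub_mem (smul_mem_familyOrder (j := 1) (k := 0) (M := |ε|) hh
    (fun p => ?_) (const_mem_familyOrder hD.lap_mem))
    (smul_mem_familyOrder (j := 1) (k := 0) (M := |ε|⁻¹) hh (fun p => ?_) hv)
  · rw [norm_mul, norm_mul, norm_I, norm_real, norm_real, Real.norm_of_nonneg (hh p).1.le,
      Real.norm_eq_abs]
    apply le_of_eq
    ring
  · rw [norm_div, norm_mul, norm_I, norm_real, norm_real, Real.norm_of_nonneg (hh p).1.le,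
      Real.norm_eq_abs]
    apply le_of_eq
    ring

theorem cTilde_mem_familyOrder (hh : ∀ p, h p ∈ Ioc (0 : ℝ) 1)
    (hr : ∀ p, ‖rVec e (t p) (h p)‖ ≤ M) (hq : ∀ p, ‖qVec e (t p) (h p)‖ ≤ M * h p ^ 5)
    (hc : ∀ p, ‖cScalar ε e (t p) (h p)‖ ≤ M * h p) :
    (fun p => cTilde ε e (t p) (h p) • (1 : Module.End ℂ (Smooth n))) ∈ familyOrder h D 1 := by
  refine smul_mem_familyOrder (j := 1) (k := 0) (M := M + |ε|⁻¹ * (M * M)) hh (fun p => ?_)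
    (const_mem_familyOrder fun v hv => hv)
  have hM : 0 ≤ M := (norm_nonneg _).trans (hr p)
  have hqr : ‖((inner ℝ (qVec e (t p) (h p)) (rVec e (t p) (h p)) : ℝ) : ℂ)‖ ≤ M * M * h p := by
    rw [norm_real]
    refine (norm_inner_le_norm _ _).trans ((mul_le_mul (hq p) (hr p) (norm_nonneg _)
      (mul_nonneg hM (pow_nonneg (hh p).1.le 5))).trans ?_)
    rw [mul_right_comm]
    exact mul_le_mul_of_nonneg_left (pow_le_of_le_one (hh p).1.le (hh p).2 (by norm_num))
      (mul_nonneg hM hM)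
  rw [pow_one, add_mul, mul_assoc]
  refine norm_sub_le_of_le (hc p) ?_
  rw [norm_mul, norm_div, norm_I, norm_real, Real.norm_eq_abs, one_div]
  exact mul_le_mul_of_nonneg_left hqr (inv_nonneg.2 (abs_nonneg ε))

end Exponents

/-! ### The error of the splitting -/

section Main

variable {n : ℕ} {V₀ : Space n → ℝ} {hV : ContDiff ℝ ∞ V₀} {D : Submodule ℂ (Smooth n)}

/-- An algebraic extension of the inclusion of `D`, so that operators on `Smooth n` can be used
directly; its values off `D` are arbitrary and play no role. -/
theorem IsTestSpace.exists_toL2 (hD : IsTestSpace V₀ hV D) :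
    ∃ ι : Smooth n →ₗ[ℂ] L2 n, ∀ v ∈ D, ι v =ᵐ[volume] v.1 := by
  let ι₀ : D →ₗ[ℂ] L2 n :=
    { toFun := fun v => (hD.memLp v.1 v.2).toLp
      map_add' := fun v w => MemLp.toLp_add (hD.memLp v.1 v.2) (hD.memLp w.1 w.2)
      map_smul' := fun c v => MemLp.toLp_const_smul c (hD.memLp v.1 v.2) }
  obtain ⟨ι, hι⟩ := ι₀.exists_extend
  refine ⟨ι, fun v hv => ?_⟩
  have : ι v = (hD.memLp v hv).toLp := LinearMap.congr_fun hι ⟨v, hv⟩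
  rw [this]
  exact (hD.memLp v hv).coeFn_toLp

theorem IsExp.isGroupExp {ι : Smooth n →ₗ[ℂ] L2 n} (hι : ∀ v ∈ D, ι v =ᵐ[volume] v.1)
    {A : Module.End ℂ (Smooth n)} (hA : ∀ v ∈ D, A v ∈ D) {U : L2 n ≃ₗᵢ[ℂ] L2 n}
    (h : IsExp D A U) : IsGroupExp D ι A U := by
  obtain ⟨G, hG, -, hG', hU⟩ := h
  refine ⟨G, hG, fun v hv => ?_, hU⟩
  obtain ⟨g, hg, hd⟩ := hG' v hv (ι v) (hι v hv)
  rwa [Lp.ext (hg.trans (hι _ (hA v hv)).symm)] at hd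

end Main

end LaserSplitting

open LaserSplitting in
theorem mainTheorem5 (n : ℕ) (ε : ℝ) (hε : 0 < ε)
    (V₀ : LaserSplitting.Space n → ℝ) (hV : ContDiff ℝ ∞ V₀)
    (e : ℝ → LaserSplitting.Space n) (he : ContDiffOn ℝ 2 e (Set.Ici 0))
    (D : Submodule ℂ (LaserSplitting.Smooth n)) (hD : LaserSplitting.IsTestSpace V₀ hV D)
    (u : LaserSplitting.Smooth n) (hu : u ∈ D)
    (f : LaserSplitting.L2 n) (hf : f =ᵐ[volume] u.1) (T : ℝ) :
    ∃ C h₀ : ℝ, 0 < h₀ ∧ ∀ t ∈ Set.Icc 0 T, ∀ h ∈ Set.Ioc 0 h₀,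
      ∀ expL expC expTW expΘ : LaserSplitting.L2 n ≃ₗᵢ[ℂ] LaserSplitting.L2 n,
        LaserSplitting.IsExp D ((1 / 2 : ℂ) • LaserSplitting.L3 ε e t h) expL →
        LaserSplitting.IsExp D ((1 / 2 : ℂ) • LaserSplitting.C2 e t h) expC →
        LaserSplitting.IsExp D
          (LaserSplitting.T2 ε e t h + LaserSplitting.W3 ε V₀ hV e t h) expTW →
        LaserSplitting.IsExp D (LaserSplitting.theta4 ε V₀ hV e t h) expΘ →
        ‖expL (expC (expTW (expC (expL f)))) - expΘ f‖ ≤ C * h ^ 7 := by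
  obtain ⟨ι, hι⟩ := hD.exists_toL2
  obtain ⟨M, hM⟩ := exists_moment_bounds he T ε
  obtain rfl : ι u = f := Lp.ext ((hι u hu).trans hf.symm)
  -- All admissible `(t, h)` form one index set, so a single bound on families yields a constant
  -- uniform in both; `h₀ = 1`.
  let P := {p : ℝ × ℝ // p.1 ∈ Icc 0 T ∧ p.2 ∈ Ioc 0 1}
  let t : P → ℝ := fun p => p.1.1
  let h : P → ℝ := fun p => p.1.2
  have hh : ∀ p, h p ∈ Ioc (0 : ℝ) 1 := fun p => p.2.2
  have hM' := fun p : P => hM (t p) p.2.1 (h p) p.2.2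
  have hF := isFiltration_familyOrder (D := D) hh
  have mC := C2_mem_familyOrder (e := e) (t := t) hD hh fun p => (hM' p).2.2.2.1
  have mL := L3_mem_familyOrder (ε := ε) (e := e) (t := t) hD hh fun p => (hM' p).2.2.1
  have mX0 := X0_mem_familyOrder (ε := ε) (e := e) (t := t) hD hh fun p => (hM' p).1
  -- `Y = -s̃ᵀ∇ - L₃` is the third-order part by which `X` differs from `X₀`, apart from the scalar
  -- `c̃`.
  have mY := hF.sub_mem (hF.neg_mem
    (dirOp_sTilde_mem_familyOrder (e := e) (t := t) hD hh (fun p => (hM' p).2.1)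
      fun p => (hM' p).2.2.2.1)) mL
  have mZ := cTilde_mem_familyOrder (D := D) (ε := ε) (e := e) (t := t) hh (fun p => (hM' p).1)
    (fun p => (hM' p).2.2.1) fun p => (hM' p).2.2.2.2
  have hX : (fun p => T2 ε e (t p) (h p) + W3 ε V₀ hV e (t p) (h p)) =
      (fun p => X0 ε V₀ hV e (t p) (h p))
        + (-(fun p => dirOp (sTilde e (t p) (h p))) - fun p => L3 ε e (t p) (h p))
        + fun p => cTilde ε e (t p) (h p) • 1 := by
    funext p
    simp only [T2, W3, X0, Pi.add_apply, Pi.sub_apply, Pi.neg_apply]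
    abel
  have hZ : ∀ A : P → Module.End ℂ (Smooth n),
      ⁅(fun p => cTilde ε e (t p) (h p) • 1 : P → Module.End ℂ (Smooth n)), A⁆ = 0 := fun A => by
    funext p
    exact LinearMap.ext fun v => sub_eq_zero.2 (map_smul (A p) _ v).symm
  have mX : (fun p => T2 ε e (t p) (h p) + W3 ε V₀ hV e (t p) (h p)) ∈ familyOrder h D 1 := by
    rw [hX]
    exact (familyOrder h D 1).add_mem ((familyOrder h D 1).add_mem mX0
      (hF.anti (by omega) mY)) mZ
  have hΘ := hF.exponent_sub_mem (Θ := fun p => theta4 ε V₀ hV e (t p) (h p)) mX0 mY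
    ((familyOrder h D 3).add_mem mC mL) hZ hX
    (funext fun p => theta4_eq V₀ hV e (t p) hε.ne' (hh p).1.ne')
  have mΘ := hF.mem_one_of_sub_mem mX ((familyOrder h D 3).add_mem mC mL) hΘ
  obtain ⟨K, hK⟩ := exists_norm_splitting_sub_le hh ι mX mC mL hΘ hu
  refine ⟨K, 1, one_pos, fun s hs k hk expL expC expTW expΘ hL hC hTW hΘ' => ?_⟩
  let p : P := ⟨(s, k), hs, hk⟩
  exact hK p expL expC expTW expΘ
    (hL.isGroupExp hι fun v hv => D.smul_mem _ (apply_mem_of_mem_familyOrder hh mL p v hv))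
    (hC.isGroupExp hι fun v hv => D.smul_mem _ (apply_mem_of_mem_familyOrder hh mC p v hv))
    (hTW.isGroupExp hι (apply_mem_of_mem_familyOrder hh mX p))
    (hΘ'.isGroupExp hι (apply_mem_of_mem_familyOrder hh mΘ p))
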